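/- **Theorem.** $\Sigma^0_1\text{-}\mathsf{RT}^{*}\equiv^a_{\mathrm W}\mathsf{TC}_{\mathbb N^{\mathbb N}}^{*}$: the finite parallelizations of the full open Ramsey theorem and of the total continuation of closed choice on Baire space are arithmetically Weihrauch equivalent, i.e. $\Sigma^0_1\text{-}\mathsf{RT}^{*}\le^a_{\mathrm W}\mathsf{TC}_{\mathbb N^{\mathbb N}}^{*}$ and $\mathsf{TC}_{\mathbb N^{\mathbb N}}^{*}\le^a_{\mathrm W}\Sigma^0_1\text{-}\mathsf{RT}^{*}$. Here the notions are the following. *Spaces.* A represented space is a set $X$ with a partial surjection $\delta_X:\subseteq\mathbb N^{\mathbb N}\to X$; $p$ is a name for $\delta_X(p)$. Baire space $\mathbb N^{\mathbb N}$ and the space $[\mathbb N]^{\mathbb N}$ of strictly increasing functions $\mathbb N\to\mathbb N$ (a subspace of $\mathbb N^{\mathbb N}$) are represented by the (partial) identity. A name for an open set $U$ of one of these spaces is an enumeration of finite strings $\sigma$ (which may enumerate nothing) such that $U$ is the union of the sets $\{x:\sigma\sqsubset x\}$, and a name for a closed set is a name for its open complement. A name for a finite sequence consists of its length and names for its entries.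 *Problems.* A partial multivalued function $f:\subseteq X\rightrightarrows Y$ assigns to each $x\in X$ a set $f(x)\subseteq Y$, with $\operatorname{dom}(f)=\{x: f(x)\neq\emptyset\}$. A realizer of $f$, written $F\vdash f$, is a partial function $F:\subseteq\mathbb N^{\mathbb N}\to\mathbb N^{\mathbb N}$ that maps every name of every $x\in\operatorname{dom}(f)$ to a name of some $y\in f(x)$. * $\Sigma^0_1\text{-}\mathsf{RT}$ maps an open set $P\subseteq[\mathbb N]^{\mathbb N}$ to the set $\mathrm{HS}(P)\subseteq[\mathbb N]^{\mathbb N}$ of those $f$ for which either $f\circ g\in P$ for all $g\in[\mathbb N]^{\mathbb N}$, or $f\circ g\notin P$ for all $g\in[\mathbb N]^{\mathbb N}$. * $\mathsf{TC}_{\mathbb N^{\mathbb N}}$ maps a closed set $A\subseteq\mathbb N^{\mathbb N}$ to $A$ if $A\neq\emptyset$, and to $\mathbb N^{\mathbb N}$ if $A=\emptyset$. * $f^{*}$ maps a finite sequence $\langle x_i\rangle_{i<n}$ (of any length $n\ge 0$) to the set of all $\langle y_i\rangle_{i<n}$ with $y_i\in f(x_i)$ for all $i<n$. *Reducibilities.*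 $f\le_{\mathrm W}g$ means that there are computable partial functions $\Phi,\Psi:\subseteq\mathbb N^{\mathbb N}\to\mathbb N^{\mathbb N}$ such that, for every $G\vdash g$, the partial function $p\mapsto\Psi(\langle p,G(\Phi(p))\rangle)$ is a realizer of $f$. Let $\mathsf{lim}$ map a convergent sequence in $\mathbb N^{\mathbb N}$ to its limit. The jump $f'$ of $f$ is the same multivalued function, but with each name for an input replaced by a sequence in $\mathbb N^{\mathbb N}$ that converges to such a name; $\mathsf{lim}^{(n)}$ is the $n$-fold jump of $\mathsf{lim}$. A partial function $F:\subseteq\mathbb N^{\mathbb N}\to\mathbb N^{\mathbb N}$ is arithmetic if $F\le_{\mathrm W}\mathsf{lim}^{(n)}$ for some $n\in\mathbb N$. Then $f\le^a_{\mathrm W}g$ is defined as $f\le_{\mathrm W}g$, except that $\Phi$ and $\Psi$ are only required to be arithmetic; and $f\equiv^a_{\mathrm W}g$ means $f\le^a_{\mathrm W}g$ and $g\le^a_{\mathrm W}f$. -/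

import Mathlib

open Filter Topology

namespace Weihrauch

/-- Baire space `ℕ^ℕ`, with its product topology. -/
abbrev Baire : Type := ℕ → ℕ

/-- Ramsey space `[ℕ]^ℕ`: the strictly increasing elements of Baire space. -/
abbrev Ramsey : Set Baire := {f | StrictMono f}

/-! ### Computable partial functions on Baire space -/

/-- Partial recursive functionals `Γ(O, n)` of a function oracle `O : ℕ → ℕ` and a number `n`:
the clauses are those of Mathlib's `Nat.Partrec`, uniformly in `O`, together with one clause that
queries the oracle. These are the functionals computed by oracle Turing machines. -/
inductive RecFunctional : (Baire → ℕ →. ℕ) → Prop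
  | zero : RecFunctional fun _ _ => Part.some 0
  | succ : RecFunctional fun _ n => Part.some (n + 1)
  | left : RecFunctional fun _ n => Part.some n.unpair.1
  | right : RecFunctional fun _ n => Part.some n.unpair.2
  | oracle : RecFunctional fun O n => Part.some (O n)
  | pair {f h : Baire → ℕ →. ℕ} (hf : RecFunctional f) (hh : RecFunctional h) :
      RecFunctional fun O n => (f O n).bind fun a => (h O n).map fun b => Nat.pair a b
  | comp {f h : Baire → ℕ →. ℕ} (hf : RecFunctional f) (hh : RecFunctional h) :
      RecFunctional fun O n => (h O n).bind (f O)
  | prec {f h : Baire → ℕ →. ℕ} (hf : RecFunctional f) (hh : RecFunctional h) :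
      RecFunctional fun O m =>
        Nat.rec (motive := fun _ => Part ℕ) (f O m.unpair.1)
          (fun y ih => ih.bind fun i => h O (Nat.pair m.unpair.1 (Nat.pair y i))) m.unpair.2
  | rfind {f : Baire → ℕ →. ℕ} (hf : RecFunctional f) :
      RecFunctional fun O m =>
        Nat.rfind fun n => (f O (Nat.pair m n)).map fun v => decide (v = 0)

/-- A partial function `F` on Baire space is computable if some oracle machine, given any
`p ∈ dom F` as an oracle and any `n` as input, outputs `F p n`. -/
def ComputableOn (F : Baire →. Baire) : Prop :=
  ∃ Γ, RecFunctional Γ ∧ ∀ p, ∀ q ∈ F p, ∀ n, q n ∈ Γ p n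

/-- The pair `⟨p, q⟩` of two elements of Baire space: `p` on the even, `q` on the odd places. -/
def join (p q : Baire) : Baire := fun n => if n % 2 = 0 then p (n / 2) else q (n / 2)

/-- The `n`-th component `p_n` of `p = ⟨p_0, p_1, …⟩`. -/
def component (p : Baire) (n : ℕ) : Baire := fun k => p (Nat.pair n k)

/-! ### Represented spaces -/

/-- A representation of `X`: a partial surjection from Baire space onto `X`, given through its
graph; `Names p x` says that `p` is a name for `x`. -/
structure Representation (X : Type) where
  Names : Baire → X → Prop
  unique : ∀ {p x y}, Names p x → Names p y → x = y
  surj : ∀ x, ∃ p, Names p x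

/-- Subsets of Baire space, represented by the partial identity. -/
def subsetRep (S : Set Baire) : Representation S where
  Names p x := p = x
  unique h h' := Subtype.ext (h.symm.trans h')
  surj x := ⟨x, rfl⟩

/-- Baire space, represented by the identity. -/
def baireRep : Representation Baire where
  Names p x := p = x
  unique h h' := h.symm.trans h'
  surj x := ⟨x, rfl⟩

/-- Sequences in Baire space; `⟨p_0, p_1, …⟩` is the name of `(p_n)_n`. -/
def baireSeqRep : Representation (ℕ → Baire) where
  Names p s := component p = s
  unique h h' := h.symm.trans h'
  surj s := ⟨fun m => s m.unpair.1 m.unpair.2, by funext n k; simp [component]⟩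

/-- Finite sequences over a represented space: a name for `⟨x_i⟩_{i<n}` consists of the number `n`
and of names `p_0, …, p_{n-1}` for the entries. -/
def listRep {X : Type} (δ : Representation X) : Representation (List X) where
  Names p l := p 0 = l.length ∧
    ∀ (i : ℕ) (h : i < l.length), δ.Names (component (fun m => p (m + 1)) i) l[i]
  unique {p l l'} h h' :=
    List.ext_getElem (h.1.symm.trans h'.1) fun i hi hi' => δ.unique (h.2 i hi) (h'.2 i hi')
  surj l := by
    choose c hc using δ.surj
    refine ⟨fun m => Nat.casesOn m l.length fun m =>
      if h : m.unpair.1 < l.length then c l[m.unpair.1] m.unpair.2 else 0, rfl, fun i hi => ?_⟩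
    have : component (fun m => if h : m.unpair.1 < l.length
        then c l[m.unpair.1] m.unpair.2 else 0) i = c l[i] := by
      funext k; simp [component, hi]
    exact this ▸ hc l[i]

/-- `σ ⊏ x`: the finite string `σ` is a prefix of the infinite string `x`. -/
def IsPrefix (σ : List ℕ) (x : Baire) : Prop := ∀ (k : ℕ) (h : k < σ.length), σ[k] = x k

/-- The subset of `S` that is enumerated by `p`: the union of the basic open sets
`{x ∈ S | σ ⊏ x}` over all strings `σ` whose code, plus one, occurs in `p` (the value `0` gives no
information, so that the empty set has a name, too). -/
def enumerated (S : Set Baire) (p : Baire) : Set S :=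
  {x | ∃ (i : ℕ) (σ : List ℕ), p i = Encodable.encode σ + 1 ∧ IsPrefix σ x}

theorem exists_enumerated_eq (S : Set Baire) (U : TopologicalSpace.Opens S) :
    ∃ p, enumerated S p = (U : Set S) := by
  classical
  refine ⟨fun i => match (Encodable.decode i : Option (List ℕ)) with
    | some σ => if ∀ x : S, IsPrefix σ x → x ∈ U then Encodable.encode σ + 1 else 0
    | none => 0, ?_⟩
  ext x
  constructor
  · rintro ⟨i, σ, hi, hx⟩
    simp only at hi
    split at hi
    · split_ifs at hi with h
      have := Encodable.encode_injective (Nat.succ_injective hi)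
      subst this
      exact h x hx
    · simp at hi
  · intro hx
    obtain ⟨V, hV, hVU⟩ := isOpen_induced_iff.1 U.isOpen
    have hxV : (x : Baire) ∈ V := by
      have : x ∈ (Subtype.val ⁻¹' V : Set S) := by rw [hVU]; exact hx
      exact this
    obtain ⟨C, ⟨y, n, rfl⟩, hxC, hCV⟩ :=
      (PiNat.isTopologicalBasis_cylinders (fun _ : ℕ => ℕ)).exists_subset_of_mem_open hxV hV
    let σ : List ℕ := (List.range n).map y
    refine ⟨Encodable.encode σ, σ, ?_, ?_⟩
    · simp only [Encodable.encodek]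
      rw [if_pos]
      intro z hz
      have hzV : (z : Baire) ∈ V := by
        refine hCV (PiNat.mem_cylinder_iff.2 fun i hi => ?_)
        have := hz i (by simpa [σ] using hi)
        simpa [σ] using this.symm
      have : z ∈ (Subtype.val ⁻¹' V : Set S) := hzV
      rw [hVU] at this
      exact this
    · intro k hk
      have hk' : k < n := by simpa [σ] using hk
      simpa [σ] using (PiNat.mem_cylinder_iff.1 hxC k hk').symm

/-- The represented space `Σ⁰₁(S)` of the (relatively) open subsets of `S`. -/
def openRep (S : Set Baire) : Representation (TopologicalSpace.Opens S) where
  Names p U := enumerated S p = (U : Set S)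
  unique h h' := SetLike.coe_injective (h.symm.trans h')
  surj U := exists_enumerated_eq S U

/-- The represented space `Π⁰₁(ℕ^ℕ)` of the closed subsets of Baire space: a name for `A` is a name
for the open set that is the complement of `A`. -/
def closedRep : Representation (TopologicalSpace.Closeds Baire) where
  Names p A := ∀ x : Baire, x ∈ A ↔ ⟨x, trivial⟩ ∉ enumerated Set.univ p
  unique h h' := SetLike.ext fun x => (h x).trans (h' x).symm
  surj A := by
    obtain ⟨p, hp⟩ := exists_enumerated_eq Set.univ
      ⟨Subtype.val ⁻¹' (A : Set Baire)ᶜ, A.isClosed.isOpen_compl.preimage continuous_subtype_val⟩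
    exact ⟨p, fun x => by rw [hp]; simp⟩

/-- The jump of a representation: `⟨p_0, p_1, …⟩` is a name for `x` if `(p_n)_n` converges to an
original name for `x`. -/
def Representation.jump {X : Type} (δ : Representation X) : Representation X where
  Names p x := ∃ q, Tendsto (component p) atTop (𝓝 q) ∧ δ.Names q x
  unique := by
    rintro p x y ⟨q, hq, hx⟩ ⟨q', hq', hy⟩
    cases tendsto_nhds_unique hq hq'
    exact δ.unique hx hy
  surj x := by
    obtain ⟨q, hq⟩ := δ.surj x
    refine ⟨fun m => q m.unpair.2, q, ?_, hq⟩
    have : component (fun m => q m.unpair.2) = fun _ => q := by funext n k; simp [component]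
    rw [this]
    exact tendsto_const_nhds

/-! ### Problems and their operations -/

/-- A partial multivalued function between represented spaces; `sol x` is the set of its values
at `x`, and `x` is in the domain if this set is nonempty. -/
structure Problem where
  In : Type
  Out : Type
  inRep : Representation In
  outRep : Representation Out
  sol : In → Set Out

namespace Problem

def dom (f : Problem) : Set f.In := {x | (f.sol x).Nonempty}

/-- A single-valued partial function on Baire space, as a problem. -/
def ofPFun (F : Baire →. Baire) : Problem where
  In := Baire
  Out := Baire
  inRep := baireRep
  outRep := baireRep
  sol p := {q | q ∈ F p}

/-- The finite parallelization `f*`. -/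
def star (f : Problem) : Problem where
  In := List f.In
  Out := List f.Out
  inRep := listRep f.inRep
  outRep := listRep f.outRep
  sol l := {m | List.Forall₂ (fun x y => y ∈ f.sol x) l m}

/-- The jump `f'`: the same multivalued function, on the jump of the input space. -/
def jump (f : Problem) : Problem := { f with inRep := f.inRep.jump }

/-- The total continuation `Tf`: outside of the domain of `f` every output is allowed. -/
def total (f : Problem) : Problem :=
  { f with sol := fun x => {y | x ∈ f.dom → y ∈ f.sol x} }

end Problem

/-! ### Realizers and reducibilities -/

/-- The partial function `F` is a realizer of `f`. -/
def Realizes (F : Baire →. Baire) (f : Problem) : Prop :=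
  ∀ p x, f.inRep.Names p x → x ∈ f.dom → ∃ q ∈ F p, ∃ y ∈ f.sol x, f.outRep.Names q y

/-- The partial function `p ↦ Ψ⟨p, G(Φ(p))⟩`. -/
def transform (Φ Ψ G : Baire →. Baire) : Baire →. Baire :=
  fun p => (Φ p).bind fun a => (G a).bind fun b => Ψ (join p b)

/-- Weihrauch reducibility `f ≤_W g`. -/
def Reducible (f g : Problem) : Prop :=
  ∃ Φ Ψ : Baire →. Baire, ComputableOn Φ ∧ ComputableOn Ψ ∧
    ∀ G, Realizes G g → Realizes (transform Φ Ψ G) f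

/-- `lim`, defined on the convergent sequences in Baire space. -/
def limProblem : Problem where
  In := ℕ → Baire
  Out := Baire
  inRep := baireSeqRep
  outRep := baireRep
  sol s := {q | Tendsto s atTop (𝓝 q)}

/-- `F` is arithmetic: `F ≤_W lim^(n)` for some `n`, with `lim^(n)` the `n`-fold jump of `lim`. -/
def Arithmetic (F : Baire →. Baire) : Prop :=
  ∃ n : ℕ, Reducible (Problem.ofPFun F) (Problem.jump^[n] limProblem)

/-- Arithmetic Weihrauch reducibility `f ≤ᵃ_W g`. -/
def ArithReducible (f g : Problem) : Prop :=
  ∃ Φ Ψ : Baire →. Baire, Arithmetic Φ ∧ Arithmetic Ψ ∧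
    ∀ G, Realizes G g → Realizes (transform Φ Ψ G) f

/-- Arithmetic Weihrauch equivalence `f ≡ᵃ_W g`. -/
def ArithEquiv (f g : Problem) : Prop := ArithReducible f g ∧ ArithReducible g f

/-! ### The open Ramsey theorem and choice on Baire space -/

/-- The composition `fg` of two elements of `[ℕ]^ℕ`. -/
def Ramsey.comp (f g : Ramsey) : Ramsey := ⟨fun n => f.1 (g.1 n), fun _ _ h => f.2 (g.2 h)⟩

/-- The set of homogeneous solutions for `P ⊆ [ℕ]^ℕ`. -/
def HS (P : Set Ramsey) : Set Ramsey :=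
  {f | (∀ g, Ramsey.comp f g ∈ P) ∨ (∀ g, Ramsey.comp f g ∉ P)}

/-- The full open Ramsey theorem `Σ⁰₁-RT`. -/
def openRT : Problem where
  In := TopologicalSpace.Opens Ramsey
  Out := Ramsey
  inRep := openRep Ramsey
  outRep := subsetRep Ramsey
  sol P := HS P

/-- Closed choice `C` on Baire space. -/
def choiceBaire : Problem where
  In := TopologicalSpace.Closeds Baire
  Out := Baire
  inRep := closedRep
  outRep := baireRep
  sol A := A

/-- Total continuous choice `TC` on Baire space. -/
def totalChoiceBaire : Problem := choiceBaire.total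

end Weihrauch

/-! Ramsey to choice. Let `E` be the set of strings enumerated for an open set `P`. A strictly
increasing `f` is homogeneous for the complement of `P` iff no increasing string of `E` has all its
entries in the range of `f` (`freeOf_iff`); these `f` form a closed set. If it is empty, the finite
sets avoiding `E`, ordered by end-extension, form a well-founded tree `T`, since the union of an
infinite branch would be an infinite avoiding set. Induction along `T` (`exists_dominates`) then
gives an infinite set `Y` and a map into `T`, preserving proper extension, from the tree of those
finite subsets of `Y` that have no initial segment in `E`. Such certificates form a second closed
set. As `T` is well-founded, any certificate shows that the tree over its own `Y` is well-founded
too, so that every infinite subset of `Y` has an initial segment in `E`, which is homogeneity for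
`P`. Hence one instance of `openRT` becomes two instances of `totalChoiceBaire`: the answer to the
first is checked, and the answer to the second is used if the check fails.

Choice to Ramsey. Let the closed set `A` be given by forbidden strings `E`, and put `f` into the
open set `P` iff the tree of strings bounded by `f` without prefix in `E` is finite. If `A` has a
point `x`, every `f` has some `f ∘ g` above `x`, so a homogeneous `f` lies outside `P`. The tree
below `f` is then infinite and finitely branching, and its leftmost branch is a point of `A`. If `A`
is empty, every answer is correct.

All names and checks involved are arithmetical. To see this without normal forms, arithmetical
operators are taken to be iterated limits of total recursive ones (`LimComputable`). An unbounded
search costs one more limit, which yields closure under number quantifiers (`ArithPred.ex`). Finally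
`ArithReducible.star_of` passes from single instances to finite sequences. -/

namespace Weihrauch

/-! ### Total recursive functionals -/

/-- Total operators on Baire space that are computed by an oracle machine. -/
def TotalRec (H : Baire → Baire) : Prop := RecFunctional fun O n => Part.some (H O n)

theorem RecFunctional.congr {f h : Baire → ℕ →. ℕ} (hf : RecFunctional f)
    (e : ∀ O n, f O n = h O n) : RecFunctional h := by
  have : f = h := funext fun O => funext fun n => e O n
  exact this ▸ hf

namespace TotalRec

theorem comp {F H : Baire → Baire} (hF : TotalRec F) (hH : TotalRec H) :
    TotalRec fun O n => F O (H O n) :=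
  (RecFunctional.comp hF hH).congr fun _ _ => by simp

theorem pair {F H : Baire → Baire} (hF : TotalRec F) (hH : TotalRec H) :
    TotalRec fun O n => Nat.pair (F O n) (H O n) :=
  (RecFunctional.pair hF hH).congr fun _ _ => by simp

theorem prec {F H : Baire → Baire} (hF : TotalRec F) (hH : TotalRec H) :
    TotalRec fun O m => Nat.rec (F O m.unpair.1)
      (fun y i => H O (Nat.pair m.unpair.1 (Nat.pair y i))) m.unpair.2 := by
  refine (RecFunctional.prec hF hH).congr fun O m => ?_
  dsimp only
  generalize m.unpair.2 = k
  induction k with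
  | zero => rfl
  | succ k ih => simp only [ih, Part.bind_some]

theorem oracle : TotalRec fun O => O := RecFunctional.oracle

theorem left : TotalRec fun _ n => n.unpair.1 := RecFunctional.left

theorem right : TotalRec fun _ n => n.unpair.2 := RecFunctional.right

theorem natPrimrec {f : ℕ → ℕ} (hf : Nat.Primrec f) : TotalRec fun _ => f := by
  induction hf with
  | zero => exact RecFunctional.zero
  | succ => exact RecFunctional.succ
  | left => exact RecFunctional.left
  | right => exact RecFunctional.right
  | pair _ _ hf hg => exact hf.pair hg
  | comp _ _ hf hg => exact hf.comp hg
  | @prec f g _ _ hf hg =>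
    refine (RecFunctional.prec hf hg).congr fun O n => ?_
    simp only [Nat.unpaired]
    induction n.unpair.2 with
    | zero => rfl
    | succ k ih => simp only [ih, Part.bind_some]

theorem primrec {f : ℕ → ℕ} (hf : Primrec f) : TotalRec fun _ => f :=
  natPrimrec (Primrec.nat_iff.1 hf)

end TotalRec

/-! ### Substitution of oracles and continuity -/

theorem RecFunctional.compTotal {f : Baire → ℕ →. ℕ} {H : Baire → Baire} (hf : RecFunctional f)
    (hH : TotalRec H) : RecFunctional fun O n => f O (H O n) :=
  (RecFunctional.comp hf hH).congr fun _ _ => Part.bind_some _ _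

/-- A functional may be applied to an oracle that is itself computed from the given oracle and a
parameter. -/
theorem RecFunctional.substOracle {Γ : Baire → ℕ →. ℕ} (hΓ : RecFunctional Γ) {D : Baire → Baire}
    (hD : TotalRec D) :
    RecFunctional fun O m => Γ (fun k => D O (Nat.pair m.unpair.1 k)) m.unpair.2 := by
  -- Recursion and minimization must carry the oracle parameter `x` along: `shift` sends `⟨⟨x, a⟩,
  -- b⟩` to `⟨x, ⟨a, b⟩⟩`, and `unshift` goes back.
  have shift : TotalRec fun _ m => Nat.pair m.unpair.1.unpair.1
      (Nat.pair m.unpair.1.unpair.2 m.unpair.2) :=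
    (TotalRec.left.comp TotalRec.left).pair
      ((TotalRec.right.comp TotalRec.left).pair TotalRec.right)
  have unshift : TotalRec fun _ m => Nat.pair (Nat.pair m.unpair.1 m.unpair.2.unpair.1)
      m.unpair.2.unpair.2 :=
    (TotalRec.left.pair (TotalRec.left.comp TotalRec.right)).pair
      (TotalRec.right.comp TotalRec.right)
  induction hΓ with
  | zero => exact RecFunctional.zero
  | succ => exact RecFunctional.comp RecFunctional.succ RecFunctional.right |>.congr (by simp)
  | left => exact TotalRec.left.comp TotalRec.right
  | right => exact TotalRec.right.comp TotalRec.right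
  | oracle =>
    exact RecFunctional.congr hD fun O n => by simp
  | pair _ _ hf hh => exact RecFunctional.pair hf hh
  | comp _ _ hf hh =>
    refine (RecFunctional.comp hf (RecFunctional.pair RecFunctional.left hh)).congr fun O n => ?_
    simp [Part.bind_map]
  | prec _ _ hf hh =>
    refine ((RecFunctional.prec hf (hh.compTotal shift)).compTotal unshift).congr fun O n => ?_
    simp
  | rfind _ hf =>
    refine (RecFunctional.rfind (hf.compTotal shift)).congr fun O n => ?_
    simp

/-- A halting computation queries only finitely many values of its oracle. Hence total recursive
operators are continuous and commute with limits. -/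
theorem RecFunctional.eventually_mem {Γ : Baire → ℕ →. ℕ} (hΓ : RecFunctional Γ) {O : Baire}
    {n v : ℕ} (h : v ∈ Γ O n) : ∀ᶠ O' in 𝓝 O, v ∈ Γ O' n := by
  induction hΓ generalizing n v with
  | zero => exact Eventually.of_forall fun _ => h
  | succ => exact Eventually.of_forall fun _ => h
  | left => exact Eventually.of_forall fun _ => h
  | right => exact Eventually.of_forall fun _ => h
  | oracle =>
    have : ∀ᶠ O' in 𝓝 O, O' n = O n := by
      have := (continuous_apply (A := fun _ : ℕ => ℕ) n).tendsto O
      rwa [nhds_discrete ℕ, tendsto_pure] at this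
    filter_upwards [this] with O' h'
    rw [h']
    exact h
  | pair _ _ hf hh =>
    obtain ⟨a, ha, hb⟩ := Part.mem_bind_iff.1 h
    obtain ⟨b, hb, e⟩ := (Part.mem_map_iff _).1 hb
    filter_upwards [hf ha, hh hb] with O' h1 h2
    exact Part.mem_bind h1 ((Part.mem_map_iff _).2 ⟨b, h2, e⟩)
  | comp _ _ hf hh =>
    obtain ⟨a, ha, hb⟩ := Part.mem_bind_iff.1 h
    filter_upwards [hh ha, hf hb] with O' h1 h2
    exact Part.mem_bind h1 h2
  | prec _ _ hf hh =>
    dsimp only at h ⊢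
    revert h
    generalize n.unpair.2 = k
    intro h
    induction k generalizing v with
    | zero => exact hf h
    | succ k ih =>
      obtain ⟨a, ha, hb⟩ := Part.mem_bind_iff.1 h
      filter_upwards [ih ha, hh hb] with O' h1 h2
      exact Part.mem_bind h1 h2
  | @rfind f _ hf =>
    obtain ⟨h0, hlt⟩ := Nat.mem_rfind.1 h
    obtain ⟨a, ha, e⟩ := (Part.mem_map_iff _).1 h0
    have key : ∀ᶠ O' in 𝓝 O, ∀ m ∈ Finset.range v,
        false ∈ (f O' (Nat.pair n m)).map fun v => decide (v = 0) :=
      (Filter.eventually_all_finset _).2 fun m hm => by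
        obtain ⟨b, hb, e'⟩ := (Part.mem_map_iff _).1 (hlt (Finset.mem_range.1 hm))
        filter_upwards [hf hb] with O' h1
        exact (Part.mem_map_iff _).2 ⟨b, h1, e'⟩
    filter_upwards [hf ha, key] with O' h1 h2
    exact Nat.mem_rfind.2 ⟨(Part.mem_map_iff _).2 ⟨a, h1, e⟩,
      fun {m} hm => h2 m (Finset.mem_range.2 hm)⟩

namespace TotalRec

theorem continuous {H : Baire → Baire} (hH : TotalRec H) : Continuous H := by
  refine continuous_pi fun n => continuous_iff_continuousAt.2 fun O => ?_
  rw [ContinuousAt, nhds_discrete ℕ, tendsto_pure]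
  filter_upwards [RecFunctional.eventually_mem hH (O := O) (n := n) (Part.mem_some _)] with O' h
  exact (Part.mem_some_iff.1 h).symm

theorem substOracle {F D : Baire → Baire} (hF : TotalRec F) (hD : TotalRec D) :
    TotalRec fun O m => F (fun k => D O (Nat.pair m.unpair.1 k)) m.unpair.2 :=
  RecFunctional.substOracle hF hD

theorem of_comp {F D : Baire → Baire} (hF : TotalRec F) (hD : TotalRec D) :
    TotalRec fun O => F (D O) := by
  refine ((hF.substOracle (hD.comp right)).comp
    ((natPrimrec Nat.Primrec.zero).pair (primrec Primrec.id))).congr fun O n => ?_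
  simp

theorem computableOn {H : Baire → Baire} (hH : TotalRec H) :
    ComputableOn fun p => Part.some (H p) :=
  ⟨_, hH, fun p q hq n => by rw [Part.mem_some_iff.1 hq]; exact Part.mem_some _⟩

end TotalRec

/-- The even half of `⟨p, q⟩`. -/
def evenPart (p : Baire) : Baire := fun n => p (2 * n)

/-- The odd half of `⟨p, q⟩`. -/
def oddPart (p : Baire) : Baire := fun n => p (2 * n + 1)

@[simp] theorem evenPart_join (p q : Baire) : evenPart (join p q) = p := by
  funext n; simp [evenPart, join]

@[simp] theorem oddPart_join (p q : Baire) : oddPart (join p q) = q := by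
  funext n
  have : (2 * n + 1) / 2 = n := by omega
  simp [oddPart, join, this]

theorem totalRec_evenPart : TotalRec evenPart :=
  TotalRec.oracle.comp (TotalRec.primrec Primrec.nat_double)

theorem totalRec_oddPart : TotalRec oddPart :=
  TotalRec.oracle.comp (TotalRec.primrec Primrec.nat_double_succ)

theorem continuous_join : Continuous fun x : Baire × Baire => join x.1 x.2 := by
  refine continuous_pi fun n => ?_
  unfold join
  split_ifs
  · exact (continuous_apply _).comp continuous_fst
  · exact (continuous_apply _).comp continuous_snd

/-! ### Iterated limits -/

/-- `r` is the result of `n` nested limits of components, starting from `p`. -/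
def LimIter : ℕ → Baire → Baire → Prop
  | 0, p, r => p = r
  | n + 1, p, r => ∃ q, Tendsto (component p) atTop (𝓝 q) ∧ LimIter n q r

namespace LimIter

theorem trans {n m : ℕ} {p q r : Baire} (h : LimIter n p q) (h' : LimIter m q r) :
    LimIter (m + n) p r := by
  induction n generalizing p with
  | zero => cases h; exact h'
  | succ n ih =>
    obtain ⟨s, hs, h⟩ := h
    exact ⟨s, hs, ih h⟩

end LimIter

theorem component_const (p : Baire) : component (fun m => p m.unpair.2) = fun _ => p := by
  funext n k; simp [component]

/-- Repeating an operator `m` times as a constant sequence. -/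
theorem exists_totalRec_pad (m : ℕ) : ∃ K, TotalRec K ∧ ∀ n p r, LimIter n p r →
    LimIter (n + m) (K p) r := by
  induction m with
  | zero => exact ⟨_, TotalRec.oracle, fun _ _ _ h => h⟩
  | succ m ih =>
    obtain ⟨K, hK, h⟩ := ih
    refine ⟨fun p j => K p j.unpair.2, hK.comp TotalRec.right, fun n p r hr => ?_⟩
    exact ⟨K p, by rw [component_const]; exact tendsto_const_nhds, h n p r hr⟩

/-- A total recursive operator of two arguments can be moved inside iterated limits. -/
theorem exists_totalRec_limIter {K : Baire → Baire} (hK : TotalRec K) (n : ℕ) :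
    ∃ K', TotalRec K' ∧ ∀ p₁ p₂ r₁ r₂, LimIter n p₁ r₁ → LimIter n p₂ r₂ →
      LimIter n (K' (join p₁ p₂)) (K (join r₁ r₂)) := by
  induction n with
  | zero => exact ⟨K, hK, by rintro p₁ p₂ r₁ r₂ rfl rfl; rfl⟩
  | succ n ih =>
    obtain ⟨K', hK', h⟩ := ih
    -- At `⟨i, k⟩`, `D p` is the `k`-th value of the join of the two `i`-th components, so the
    -- operator below applies `K'` to every pair of components at once.
    let D : Baire → Baire := fun p m =>
      join (component (evenPart p) m.unpair.1) (component (oddPart p) m.unpair.1) m.unpair.2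
    have hD : TotalRec D := by
      have hidx : Primrec fun m : ℕ =>
          2 * Nat.pair m.unpair.1 (m.unpair.2 / 2) + m.unpair.2 % 2 := by
        have hu : Primrec Nat.unpair := Primrec.unpair
        have h2 := Primrec.snd.comp hu
        exact Primrec.nat_add.comp (Primrec.nat_double.comp (Primrec₂.natPair.comp
          (Primrec.fst.comp hu) (Primrec.nat_div.comp h2 (Primrec.const 2))))
          (Primrec.nat_mod.comp h2 (Primrec.const 2))
      refine (TotalRec.oracle.comp (TotalRec.primrec hidx)).congr fun p m => ?_
      simp only [D, join, component, evenPart, oddPart]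
      split_ifs with h0
      · simp [h0]
      · rw [Nat.mod_two_ne_zero.1 h0]
    refine ⟨fun p m => K' (fun k => D p (Nat.pair m.unpair.1 k)) m.unpair.2,
      hK'.substOracle hD, ?_⟩
    rintro p₁ p₂ r₁ r₂ ⟨q₁, hq₁, h₁⟩ ⟨q₂, hq₂, h₂⟩
    refine ⟨K' (join q₁ q₂), ?_, h _ _ _ _ h₁ h₂⟩
    have : component (fun m => K' (fun k => D (join p₁ p₂) (Nat.pair m.unpair.1 k)) m.unpair.2) =
        fun i => K' (join (component p₁ i) (component p₂ i)) := by
      funext i k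
      simp [component, D]
    rw [this]
    exact (hK'.continuous.tendsto _).comp
      ((continuous_join.tendsto (q₁, q₂)).comp (hq₁.prodMk_nhds hq₂))

/-! ### Unbounded search as a limit -/

theorem LimIter.snoc {n : ℕ} {p q r : Baire} (h : LimIter n p q)
    (h' : Tendsto (component q) atTop (𝓝 r)) : LimIter (n + 1) p r := by
  rw [add_comm]
  exact h.trans ⟨r, h', rfl⟩

/-- The successor of the least zero below `m` of `k ↦ q ⟨n, k⟩`, or `0` if there is none. -/
def boundedSearch (q : Baire) (n m : ℕ) : ℕ :=
  Nat.rec 0 (fun y i => if i = 0 then (if q (Nat.pair n y) = 0 then y + 1 else 0) else i) m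

theorem totalRec_boundedSearch :
    TotalRec fun q m => (boundedSearch q m.unpair.2 m.unpair.1).pred := by
  have hu : Primrec Nat.unpair := Primrec.unpair
  have hsel : Primrec fun m : ℕ => if m.unpair.2.unpair.2.unpair.2 = 0 then
      (if m.unpair.1 = 0 then m.unpair.2.unpair.2.unpair.1 + 1 else 0)
      else m.unpair.2.unpair.2.unpair.2 := by
    have h2 := hu.comp (Primrec.snd.comp (hu.comp (Primrec.snd.comp hu)))
    have h0 := Primrec.const (α := ℕ) 0
    exact Primrec.ite (Primrec.eq.comp (Primrec.snd.comp h2) h0)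
      (Primrec.ite (Primrec.eq.comp (Primrec.fst.comp hu) h0)
        (Primrec.succ.comp (Primrec.fst.comp h2)) h0) (Primrec.snd.comp h2)
  have hq : TotalRec fun q m => q (Nat.pair m.unpair.1 m.unpair.2.unpair.1) :=
    TotalRec.oracle.comp (TotalRec.left.pair (TotalRec.left.comp TotalRec.right))
  have := ((TotalRec.primrec Primrec.pred).comp (TotalRec.prec (TotalRec.natPrimrec .zero)
    ((TotalRec.primrec hsel).comp (hq.pair (TotalRec.primrec Primrec.id))))).comp
      (TotalRec.right.pair TotalRec.left)
  simpa [boundedSearch] using this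

theorem boundedSearch_eq_zero {q : Baire} {n m : ℕ} (h : ∀ k < m, q (Nat.pair n k) ≠ 0) :
    boundedSearch q n m = 0 := by
  induction m with
  | zero => rfl
  | succ m ih =>
    have := ih fun k hk => h k (hk.trans m.lt_succ_self)
    simp only [boundedSearch] at this ⊢
    simp [this, h m m.lt_succ_self]

theorem boundedSearch_eq_succ {q : Baire} {n k m : ℕ} (h0 : q (Nat.pair n k) = 0)
    (h : ∀ j < k, q (Nat.pair n j) ≠ 0) (hm : k < m) : boundedSearch q n m = k + 1 := by
  induction m, hm using Nat.le_induction with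
  | base =>
    have := boundedSearch_eq_zero h
    simp only [boundedSearch] at this ⊢
    simp [this, h0]
  | succ m _ ih =>
    simp only [boundedSearch] at ih ⊢
    simp [ih]

theorem tendsto_boundedSearch (q : Baire) :
    Tendsto (component fun m => (boundedSearch q m.unpair.2 m.unpair.1).pred) atTop
      (𝓝 fun n => sInf {k | q (Nat.pair n k) = 0}) := by
  refine tendsto_pi_nhds.2 fun n => ?_
  rw [nhds_discrete ℕ, tendsto_pure]
  by_cases h : ∃ k, q (Nat.pair n k) = 0
  · have hk : sInf {k | q (Nat.pair n k) = 0} ∈ {k | q (Nat.pair n k) = 0} := Nat.sInf_mem h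
    filter_upwards [eventually_gt_atTop (sInf {k | q (Nat.pair n k) = 0})] with m hm
    have := boundedSearch_eq_succ hk (fun j hj =>
      Nat.notMem_of_lt_sInf (s := {k | q (Nat.pair n k) = 0}) hj) hm
    simp only [component, Nat.unpair_pair, this, Nat.pred_succ]
  -- Without a zero the search stays at `0`, and `0` is also the value of `sInf` on the empty set.
  · push Not at h
    refine Eventually.of_forall fun m => ?_
    simp [component, boundedSearch_eq_zero fun k _ => h k, h]

/-- Operators on Baire space that are iterated limits of a total recursive operator. -/
def LimComputable (F : Baire → Baire) : Prop :=
  ∃ n H, TotalRec H ∧ ∀ p, LimIter n (H p) (F p)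

theorem TotalRec.limComputable {F : Baire → Baire} (hF : TotalRec F) : LimComputable F :=
  ⟨0, F, hF, fun _ => rfl⟩

namespace LimComputable

/-- The two numbers of limits are made equal by padding with constant sequences; then `K` moves
inside the limits by continuity. -/
theorem map₂ {F₁ F₂ K : Baire → Baire} (h₁ : LimComputable F₁) (h₂ : LimComputable F₂)
    (hK : TotalRec K) : LimComputable fun p => K (join (F₁ p) (F₂ p)) := by
  obtain ⟨n₁, H₁, hH₁, h₁⟩ := h₁
  obtain ⟨n₂, H₂, hH₂, h₂⟩ := h₂
  obtain ⟨K₁, hK₁, k₁⟩ := exists_totalRec_pad n₂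
  obtain ⟨K₂, hK₂, k₂⟩ := exists_totalRec_pad n₁
  obtain ⟨K', hK', k⟩ := exists_totalRec_limIter hK (n₁ + n₂)
  refine ⟨n₁ + n₂, fun p => K' (join (K₁ (H₁ p)) (K₂ (H₂ p))), ?_, fun p =>
    k _ _ _ _ (k₁ _ _ _ (h₁ p)) (add_comm n₁ n₂ ▸ k₂ _ _ _ (h₂ p))⟩
  refine hK'.of_comp (?_ : TotalRec fun p => join (K₁ (H₁ p)) (K₂ (H₂ p)))
  have hz : TotalRec fun p n => Nat.pair (K₁ (H₁ p) (n / 2)) (K₂ (H₂ p) (n / 2)) :=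
    ((hK₁.of_comp hH₁).comp (TotalRec.primrec Primrec.nat_div2)).pair
      ((hK₂.of_comp hH₂).comp (TotalRec.primrec Primrec.nat_div2)) |>.congr
      (by simp [Nat.div2_val])
  have hsel : Primrec fun m : ℕ =>
      if m.unpair.1 % 2 = 0 then m.unpair.2.unpair.1 else m.unpair.2.unpair.2 := by
    have hu : Primrec Nat.unpair := Primrec.unpair
    have hu2 := hu.comp (Primrec.snd.comp hu)
    exact Primrec.ite (Primrec.eq.comp (Primrec.nat_mod.comp (Primrec.fst.comp hu)
      (Primrec.const 2)) (Primrec.const 0)) (Primrec.fst.comp hu2) (Primrec.snd.comp hu2)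
  refine ((TotalRec.primrec hsel).comp ((TotalRec.primrec Primrec.id).pair hz)).congr fun p n => ?_
  simp [join]

/-- Bounded search is total recursive, so it moves inside the limits that define `F`; letting its
bound tend to infinity costs one further limit. -/
theorem search {F : Baire → Baire} (hF : LimComputable F) :
    LimComputable fun p n => sInf {k | F p (Nat.pair n k) = 0} := by
  obtain ⟨n, H, hH, h⟩ := by
    simpa using hF.map₂ hF (totalRec_boundedSearch.of_comp totalRec_evenPart)
  exact ⟨n + 1, H, hH, fun p => (h p).snoc (tendsto_boundedSearch (F p))⟩

theorem id : LimComputable fun p => p := TotalRec.oracle.limComputable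

theorem comp {F G : Baire → Baire} (hF : LimComputable F) (hG : LimComputable G) :
    LimComputable fun p n => F p (G p n) := by
  simpa using hF.map₂ hG (totalRec_evenPart.comp totalRec_oddPart)

theorem pair {F G : Baire → Baire} (hF : LimComputable F) (hG : LimComputable G) :
    LimComputable fun p n => Nat.pair (F p n) (G p n) := by
  simpa using hF.map₂ hG (totalRec_evenPart.pair totalRec_oddPart)

theorem primrec {f : ℕ → ℕ} (hf : Primrec f) : LimComputable fun _ => f :=
  (TotalRec.primrec hf).limComputable

theorem of_comp {F D : Baire → Baire} (hF : LimComputable F) (hD : TotalRec D) :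
    LimComputable fun p => F (D p) := by
  obtain ⟨n, H, hH, h⟩ := hF
  exact ⟨n, _, hH.of_comp hD, fun p => h (D p)⟩

end LimComputable

/-! ### Iterated limits are arithmetic -/

/-- `p` is a name of an instance of `f` whose solutions only have the name `r`. -/
def Problem.Forces (f : Problem) (p r : Baire) : Prop :=
  ∃ x, f.inRep.Names p x ∧ x ∈ f.dom ∧ ∀ y ∈ f.sol x, ∀ q, f.outRep.Names q y → q = r

theorem Problem.Forces.jump {f : Problem} {p q r : Baire} (h : f.Forces q r)
    (hp : Tendsto (component p) atTop (𝓝 q)) : f.jump.Forces p r := by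
  obtain ⟨x, hx, hd, hu⟩ := h
  exact ⟨x, ⟨q, hp, hx⟩, hd, hu⟩

theorem Problem.Forces.mem {f : Problem} {p r : Baire} (h : f.Forces p r) {G : Baire →. Baire}
    (hG : Realizes G f) : r ∈ G p := by
  obtain ⟨x, hx, hd, hu⟩ := h
  obtain ⟨q, hq, y, hy, hqy⟩ := hG p x hx hd
  exact hu y hy q hqy ▸ hq

/-- `lim` takes one limit and each jump adds one, whence the shift from `n` to `n + 1`. -/
theorem LimIter.forces {n : ℕ} {p r : Baire} (h : LimIter (n + 1) p r) :
    (Problem.jump^[n] limProblem).Forces p r := by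
  induction n generalizing p with
  | zero =>
    obtain ⟨q, hq, rfl⟩ := h
    exact ⟨component p, rfl, ⟨q, hq⟩, fun y hy q' hq' => hq'.trans (tendsto_nhds_unique hy hq)⟩
  | succ n ih =>
    obtain ⟨q, hq, h⟩ := h
    rw [Function.iterate_succ_apply']
    exact (ih h).jump hq

theorem LimComputable.arithmetic {F : Baire → Baire} (hF : LimComputable F) :
    Arithmetic fun p => Part.some (F p) := by
  obtain ⟨n, H, hH, h⟩ := hF
  -- One dummy limit makes the number of limits positive.
  obtain ⟨K, hK, k⟩ := exists_totalRec_pad 1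
  refine ⟨n, _, _, (hK.of_comp hH).computableOn, totalRec_oddPart.computableOn, fun G hG => ?_⟩
  rintro p x rfl -
  refine ⟨F p, ?_, F p, Part.mem_some _, rfl⟩
  refine Part.mem_bind (Part.mem_some _) (Part.mem_bind ((k _ _ _ (h p)).forces.mem hG) ?_)
  change F p ∈ Part.some (oddPart (join p (F p)))
  rw [oddPart_join]
  exact Part.mem_some _

/-! ### Arithmetical functions and predicates with an oracle -/

section ArithFun

open Encodable

variable {α β γ δ : Type} [Primcodable α] [Primcodable β] [Primcodable γ] [Primcodable δ]

/-- Functions of an oracle and an encodable argument that are arithmetical. -/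
def ArithFun (F : Baire → α → β) : Prop :=
  ∃ G, LimComputable G ∧ ∀ O a, G O (encode a) = encode (F O a)

/-- Arithmetical predicates of an oracle and an encodable argument. -/
def ArithPred (R : Baire → α → Prop) : Prop :=
  ∃ G, LimComputable G ∧ ∀ O a, R O a ↔ G O (encode a) = 0

namespace ArithFun

theorem of_primrec {f : α → β} (hf : Primrec f) : ArithFun fun _ => f := by
  -- The code of `some b` is the code of `b` plus one, which `Nat.pred` undoes.
  refine ⟨_, LimComputable.primrec (f := fun n => (encode ((decode n : Option α).map f)).pred)
    (Primrec.pred.comp (Primrec.nat_iff.2 hf)), fun O a => by simp⟩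

theorem comp {F : Baire → β → γ} {H : Baire → α → β} (hF : ArithFun F) (hH : ArithFun H) :
    ArithFun fun O a => F O (H O a) := by
  obtain ⟨f, hf, ef⟩ := hF
  obtain ⟨g, hg, eg⟩ := hH
  exact ⟨_, hf.comp hg, fun O a => by rw [eg, ef]⟩

theorem prim {f : β → γ} (hf : Primrec f) {H : Baire → α → β} (hH : ArithFun H) :
    ArithFun fun O a => f (H O a) :=
  (of_primrec hf).comp hH

theorem pair {F : Baire → α → β} {H : Baire → α → γ} (hF : ArithFun F) (hH : ArithFun H) :
    ArithFun fun O a => (F O a, H O a) := by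
  obtain ⟨f, hf, ef⟩ := hF
  obtain ⟨g, hg, eg⟩ := hH
  exact ⟨_, hf.pair hg, fun O a => by rw [eg, ef]; rfl⟩

theorem prim₂ {f : β → γ → δ} (hf : Primrec₂ f) {F : Baire → α → β} {H : Baire → α → γ}
    (hF : ArithFun F) (hH : ArithFun H) : ArithFun fun O a => f (F O a) (H O a) :=
  prim (f := fun x : β × γ => f x.1 x.2) hf (hF.pair hH)

theorem query {F : Baire → α → ℕ} (hF : ArithFun F) : ArithFun fun O a => O (F O a) := by
  obtain ⟨f, hf, ef⟩ := hF
  exact ⟨_, LimComputable.id.comp hf, fun O a => by rw [ef]; rfl⟩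

theorem of_oracle {F : Baire → α → β} (hF : ArithFun F) {D : Baire → Baire} (hD : TotalRec D) :
    ArithFun fun O a => F (D O) a := by
  obtain ⟨f, hf, ef⟩ := hF
  exact ⟨_, hf.of_comp hD, fun O a => ef _ _⟩

theorem limComputable {F : Baire → Baire} (hF : ArithFun F) : LimComputable F := by
  obtain ⟨f, hf, ef⟩ := hF
  have : f = F := funext fun O => funext fun n => ef O n
  exact this ▸ hf

theorem search {R : Baire → α → ℕ → Prop} (hR : ArithPred fun O (x : α × ℕ) => R O x.1 x.2) :
    ArithFun fun O a => sInf {k | R O a k} := by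
  obtain ⟨f, hf, ef⟩ := hR
  exact ⟨_, hf.search, fun O a => congrArg sInf (Set.ext fun k => (ef O (a, k)).symm)⟩

end ArithFun

namespace ArithPred

theorem of_oracle {R : Baire → α → Prop} (hR : ArithPred R) {D : Baire → Baire}
    (hD : TotalRec D) : ArithPred fun O a => R (D O) a := by
  obtain ⟨f, hf, ef⟩ := hR
  exact ⟨_, hf.of_comp hD, fun O a => ef _ _⟩

theorem comp {R : Baire → β → Prop} (hR : ArithPred R) {F : Baire → α → β} (hF : ArithFun F) :
    ArithPred fun O a => R O (F O a) := by
  obtain ⟨f, hf, ef⟩ := hR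
  obtain ⟨g, hg, eg⟩ := hF
  exact ⟨_, hf.comp hg, fun O a => by rw [eg]; exact ef _ _⟩

theorem of_primrecPred {p : α → Prop} (hp : PrimrecPred p) : ArithPred fun _ => p := by
  obtain ⟨_, hp⟩ := hp
  obtain ⟨f, hf, ef⟩ := ArithFun.of_primrec (Primrec.encode.comp (Primrec.not.comp hp))
  refine ⟨f, hf, fun O a => ?_⟩
  rw [ef O a]
  by_cases h : p a <;> simp [h]

theorem rel {r : β → γ → Prop} (hr : PrimrecRel r) {F : Baire → α → β} {H : Baire → α → γ}
    (hF : ArithFun F) (hH : ArithFun H) : ArithPred fun O a => r (F O a) (H O a) :=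
  (of_primrecPred hr).comp (hF.pair hH)

theorem eq {F H : Baire → α → β} (hF : ArithFun F) (hH : ArithFun H) :
    ArithPred fun O a => F O a = H O a := rel Primrec.eq hF hH

theorem lt {F H : Baire → α → ℕ} (hF : ArithFun F) (hH : ArithFun H) :
    ArithPred fun O a => F O a < H O a := rel Primrec.nat_lt hF hH

theorem le {F H : Baire → α → ℕ} (hF : ArithFun F) (hH : ArithFun H) :
    ArithPred fun O a => F O a ≤ H O a := rel Primrec.nat_le hF hH

/-- The characteristic function of an arithmetical predicate. -/
theorem exists_arithFun {R : Baire → α → Prop} (hR : ArithPred R) :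
    ∃ f : Baire → α → ℕ, ArithFun f ∧ ∀ O a, R O a ↔ f O a = 0 := by
  obtain ⟨f, hf, ef⟩ := hR
  exact ⟨fun O a => f O (encode a), ⟨f, hf, fun _ _ => rfl⟩, ef⟩

theorem of_arithFun {R : Baire → α → Prop} {f : Baire → α → ℕ} (hf : ArithFun f)
    (h : ∀ O a, R O a ↔ f O a = 0) : ArithPred R := by
  obtain ⟨g, hg, eg⟩ := hf
  exact ⟨g, hg, fun O a => by rw [h, eg]; rfl⟩

theorem of_iff {R R' : Baire → α → Prop} (hR : ArithPred R) (h : ∀ O a, R' O a ↔ R O a) :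
    ArithPred R' := by
  obtain ⟨g, hg, eg⟩ := hR
  exact ⟨g, hg, fun O a => by rw [h, eg]⟩

theorem and {R R' : Baire → α → Prop} (hR : ArithPred R) (hR' : ArithPred R') :
    ArithPred fun O a => R O a ∧ R' O a := by
  obtain ⟨f, hf, ef⟩ := hR.exists_arithFun
  obtain ⟨g, hg, eg⟩ := hR'.exists_arithFun
  exact of_arithFun (ArithFun.prim₂ Primrec.nat_add hf hg) fun O a => by simp [ef, eg]

theorem not {R : Baire → α → Prop} (hR : ArithPred R) : ArithPred fun O a => ¬R O a := by
  obtain ⟨f, hf, ef⟩ := hR.exists_arithFun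
  exact of_iff (lt (ArithFun.of_primrec (Primrec.const 0)) hf) fun O a => by
    rw [ef, Nat.pos_iff_ne_zero]

theorem or {R R' : Baire → α → Prop} (hR : ArithPred R) (hR' : ArithPred R') :
    ArithPred fun O a => R O a ∨ R' O a :=
  (hR.not.and hR'.not).not.of_iff fun O a => by tauto

theorem imp {R R' : Baire → α → Prop} (hR : ArithPred R) (hR' : ArithPred R') :
    ArithPred fun O a => R O a → R' O a :=
  (hR.and hR'.not).not.of_iff fun O a => by tauto

/-- The least code of a witness is found by `search` and then tested. If there is no witness, the
search returns `0` and the test fails as it should. -/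
theorem ex {R : Baire → α → γ → Prop} (hR : ArithPred fun O (x : α × γ) => R O x.1 x.2) :
    ArithPred fun O a => ∃ c, R O a c := by
  obtain ⟨f, hf, ef⟩ := hR
  obtain ⟨g, hg, eg⟩ := of_primrecPred (Primcodable.mem_range_encode (α := γ))
  -- The second summand rejects numbers that code no element of `γ`.
  let K : Baire → Baire := fun O n => f O n + g O n.unpair.2
  have hK : LimComputable K := by
    have := (LimComputable.primrec (f := fun n => n.unpair.1 + n.unpair.2)
      (Primrec.nat_add.comp (Primrec.fst.comp Primrec.unpair) (Primrec.snd.comp Primrec.unpair))).comp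
        (hf.pair (hg.comp TotalRec.right.limComputable))
    simpa using this
  have e : ∀ O a, (∃ c, R O a c) ↔ ∃ k, K O (Nat.pair (encode a) k) = 0 := by
    intro O a
    constructor
    · rintro ⟨c, hc⟩
      refine ⟨encode c, ?_⟩
      have h1 : f O (Nat.pair (encode a) (encode c)) = 0 := (ef O (a, c)).1 hc
      have h2 : g O (encode c) = 0 := (eg O (encode c)).1 ⟨c, rfl⟩
      simp [K, h1, h2]
    · rintro ⟨k, hk⟩
      simp only [K, Nat.unpair_pair, Nat.add_eq_zero_iff] at hk
      obtain ⟨c, rfl⟩ := (eg O k).2 hk.2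
      exact ⟨c, (ef O (a, c)).2 hk.1⟩
  refine ⟨fun O n => K O (Nat.pair n (sInf {k | K O (Nat.pair n k) = 0})),
    hK.comp (LimComputable.pair (LimComputable.primrec Primrec.id) hK.search), fun O a => ?_⟩
  refine (e O a).trans ?_
  exact ⟨fun h => Nat.sInf_mem h, fun h => ⟨_, h⟩⟩

theorem all {R : Baire → α → γ → Prop} (hR : ArithPred fun O (x : α × γ) => R O x.1 x.2) :
    ArithPred fun O a => ∀ c, R O a c :=
  (ex (R := fun O a c => ¬R O a c) hR.not).not.of_iff fun O a => by simp

end ArithPred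

open Classical in
theorem ArithFun.ite {R : Baire → α → Prop} (hR : ArithPred R) {F H : Baire → α → β}
    (hF : ArithFun F) (hH : ArithFun H) : ArithFun fun O a => if R O a then F O a else H O a := by
  obtain ⟨f, hf, ef⟩ := hR.exists_arithFun
  have : Primrec fun x : ℕ × β × β => if x.1 = 0 then x.2.1 else x.2.2 :=
    Primrec.ite (Primrec.eq.comp Primrec.fst (Primrec.const 0))
      (Primrec.fst.comp Primrec.snd) (Primrec.snd.comp Primrec.snd)
  simpa [ef] using ArithFun.prim this (hf.pair (hF.pair hH))

end ArithFun

/-! ### Combinatorics of open sets of Ramsey space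

Finite subsets of `ℕ` are represented by decreasing lists, and `E` is a set of strings which
generates an open subset of Ramsey space. -/

section Combinatorics

variable {E : Set (List ℕ)}

/-- No increasing string of `E` has all its entries in `σ`. -/
def Avoids (E : Set (List ℕ)) (σ : List ℕ) : Prop := ∀ s ∈ E, s.Pairwise (· < ·) → ¬s ⊆ σ

/-- `σ'` is a decreasing list that avoids `E` and properly extends `σ`. -/
def ProperExt (E : Set (List ℕ)) (σ' σ : List ℕ) : Prop :=
  σ'.Pairwise (· > ·) ∧ Avoids E σ' ∧ ∃ u, u ≠ [] ∧ σ' = u ++ σ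

/-- No initial segment of (the reversal of) `t` belongs to `E`. -/
def Unsecured (E : Set (List ℕ)) (t : List ℕ) : Prop := ∀ s ∈ E, ¬s.reverse <:+ t

/-- No increasing string of `E` has all its entries in the range of `x`. -/
def FreeOf (E : Set (List ℕ)) (x : Baire) : Prop :=
  ∀ s ∈ E, s.Pairwise (· < ·) → ¬∀ a ∈ s, a ∈ Set.range x

theorem ProperExt.trans {σ₁ σ₂ σ₃ : List ℕ} (h : ProperExt E σ₁ σ₂) (h' : ProperExt E σ₂ σ₃) :
    ProperExt E σ₁ σ₃ := by
  obtain ⟨hp, ha, u, hu, rfl⟩ := h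
  obtain ⟨-, -, v, hv, rfl⟩ := h'
  exact ⟨hp, ha, u ++ v, by simp [hu], by simp⟩

/-- The union of an infinite chain of proper extensions is infinite. A string of `E` with entries in
the union would already have them in one member of the chain, so the increasing enumeration of the
union is free of `E`. -/
theorem wellFounded_properExt (h : ∀ x : Baire, StrictMono x → ¬FreeOf E x) :
    WellFounded (ProperExt E) := by
  rw [wellFounded_iff_isEmpty_descending_chain]
  refine ⟨fun ⟨f, hf⟩ => ?_⟩
  have hsub : ∀ n, f n ⊆ f (n + 1) := fun n => by
    obtain ⟨-, -, u, -, e⟩ := hf n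
    rw [e]
    exact List.subset_append_right _ _
  have hmono : ∀ n m, n ≤ m → f n ⊆ f m := fun n m hnm => by
    induction m, hnm using Nat.le_induction with
    | base => exact List.Subset.refl _
    | succ m _ ih => exact List.Subset.trans ih (hsub m)
  have hlen : ∀ n, n ≤ (f n).length := fun n => by
    induction n with
    | zero => exact Nat.zero_le _
    | succ n ih =>
      obtain ⟨-, -, u, hu, e⟩ := hf n
      have := List.length_pos_iff.2 hu
      rw [e, List.length_append]
      omega
  let U : Set ℕ := {a | ∃ n, a ∈ f n}
  have hU : U.Infinite := fun hfin => by
    have hsub : (f (hfin.toFinset.card + 1)).toFinset ⊆ hfin.toFinset := fun a ha =>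
      hfin.mem_toFinset.2 ⟨_, List.mem_toFinset.1 ha⟩
    have h1 := Finset.card_le_card hsub
    rw [List.toFinset_card_of_nodup ((hf _).1.imp fun h => h.ne')] at h1
    exact absurd (hlen (hfin.toFinset.card + 1)) (by omega)
  have := hU.to_subtype
  classical
  refine h (Nat.orderEmbeddingOfSet U) (Nat.orderEmbeddingOfSet U).strictMono ?_
  intro s hs hp hsr
  have : ∃ n, ∀ a ∈ s, a ∈ f n := by
    clear hs hp
    induction s with
    | nil => exact ⟨0, by simp⟩
    | cons b s ih =>
      obtain ⟨n, hn⟩ := ih fun a ha => hsr a (List.mem_cons_of_mem _ ha)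
      have hb := hsr b List.mem_cons_self
      rw [Nat.orderEmbeddingOfSet_range] at hb
      obtain ⟨m, hm⟩ := hb
      refine ⟨max n m, fun a ha => ?_⟩
      rcases List.mem_cons.1 ha with rfl | ha
      · exact hmono _ _ (le_max_right _ _) hm
      · exact hmono _ _ (le_max_left _ _) (hn a ha)
  obtain ⟨n, hn⟩ := this
  exact (hf n).2.1 s hs hp (List.Subset.trans hn (hsub n))

/-- The tree of unsecured extensions of `τ` by elements of `Y` can be mapped monotonically
into the tree of proper extensions of `σ`. -/
inductive Dominates (E : Set (List ℕ)) (Y : Set ℕ) : List ℕ → List ℕ → Prop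
  | mk {σ τ : List ℕ} (g : ℕ → List ℕ)
    (ext : ∀ a ∈ Y, (∀ b ∈ τ, b < a) → Unsecured E (a :: τ) → ProperExt E (g a) σ)
    (dom : ∀ a ∈ Y, (∀ b ∈ τ, b < a) → Unsecured E (a :: τ) → Dominates E Y (g a) (a :: τ)) :
    Dominates E Y σ τ

namespace Dominates

variable {Y Z : Set ℕ} {σ σ' τ : List ℕ}

theorem intro (h : ∀ a ∈ Y, (∀ b ∈ τ, b < a) → Unsecured E (a :: τ) →
    ∃ σ', ProperExt E σ' σ ∧ Dominates E Y σ' (a :: τ)) : Dominates E Y σ τ := by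
  choose! g hg using h
  exact ⟨g, fun a h1 h2 h3 => (hg a h1 h2 h3).1, fun a h1 h2 h3 => (hg a h1 h2 h3).2⟩

theorem elim (h : Dominates E Y σ τ) {a : ℕ} (ha : a ∈ Y) (hb : ∀ b ∈ τ, b < a)
    (hu : Unsecured E (a :: τ)) : ∃ σ', ProperExt E σ' σ ∧ Dominates E Y σ' (a :: τ) := by
  cases h with
  | mk g ext dom => exact ⟨g a, ext a ha hb hu, dom a ha hb hu⟩

theorem of_properExt (h : Dominates E Y σ' τ) (h' : ProperExt E σ' σ) : Dominates E Y σ τ :=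
  intro fun _ ha hb hu => (h.elim ha hb hu).imp fun _ h => ⟨h.1.trans h', h.2⟩

theorem mono (h : Dominates E Z σ τ) (hYZ : ∀ b ∈ Y, (∀ c ∈ τ, c < b) → b ∈ Z) :
    Dominates E Y σ τ := by
  induction h with
  | mk g ext _ ih =>
    refine ⟨g, fun a ha hb => ext a (hYZ a ha hb) hb, fun a ha hb hu =>
      ih a (hYZ a ha hb) hb hu fun b hbY hc => hYZ b hbY fun c hcτ => ?_⟩
    exact hc c (List.mem_cons_of_mem _ hcτ)

end Dominates

/-! ### Construction of certificates -/

theorem exists_lt_forall_mem {Z : Set ℕ} (hZ : Z.Infinite) (σ : List ℕ) :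
    ∃ x ∈ Z, ∀ b ∈ σ, b < x := by
  obtain ⟨x, hx, hlt⟩ := hZ.exists_gt σ.sum
  exact ⟨x, hx, fun b hb => (List.le_sum_of_mem hb).trans_lt hlt⟩

/-- One step of the construction in `exists_dominates`, under the assumption that the claim fails
for `σ` inside `Z`. Take `x` in `Z` above `σ`. If `x :: σ` avoids `E`, the induction hypothesis
gives a sublist of `x :: σ`; it must contain `x`, as otherwise it would serve for `σ`. If not, some
string of `E` lies in `x :: σ`; it contains `x` because `σ` avoids `E`, so its reversal `x :: τ` is
secured and nothing is required. -/
theorem exists_cons_dominates {σ : List ℕ} (hσ : σ.Pairwise (· > ·)) (ha : Avoids E σ)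
    (ih : ∀ σ', ProperExt E σ' σ → ∀ X : Set ℕ, X.Infinite →
      ∃ Y ⊆ X, Y.Infinite ∧ ∃ τ, τ.Sublist σ' ∧ Dominates E Y σ' τ)
    {Z : Set ℕ} (hZ : Z.Infinite)
    (hne : ∀ Y ⊆ Z, Y.Infinite → ∀ τ, τ.Sublist σ → ¬Dominates E Y σ τ) :
    ∃ x ∈ Z, ∃ Y ⊆ Z, Y.Infinite ∧ ∃ τ, τ.Sublist σ ∧
      (Unsecured E (x :: τ) → ∃ σ', ProperExt E σ' σ ∧ Dominates E Y σ' (x :: τ)) := by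
  obtain ⟨x, hx, hlt⟩ := exists_lt_forall_mem hZ σ
  have hp : (x :: σ).Pairwise (· > ·) := List.pairwise_cons.2 ⟨hlt, hσ⟩
  refine ⟨x, hx, ?_⟩
  by_cases h : Avoids E (x :: σ)
  · have pe : ProperExt E (x :: σ) σ := ⟨hp, h, [x], by simp, rfl⟩
    obtain ⟨Y, hYZ, hY, τ, hτ, hd⟩ := ih _ pe Z hZ
    rcases List.sublist_cons_iff.1 hτ with hτ | ⟨r, rfl, hr⟩
    · exact absurd (hd.of_properExt pe) (hne Y hYZ hY τ hτ)
    · exact ⟨Y, hYZ, hY, r, hr, fun _ => ⟨_, pe, hd⟩⟩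
  · simp only [Avoids, not_forall, not_not] at h
    obtain ⟨s, hs, hsp, hsub⟩ := h
    have hrev : s.reverse.Pairwise (· > ·) := List.pairwise_reverse.2 hsp
    have hsl : s.reverse.Sublist (x :: σ) :=
      List.sublist_of_subperm_of_pairwise
        ((List.subperm_of_subset (hrev.imp fun h => h.ne') (by simpa using hsub)))
        hrev hp
    rcases List.sublist_cons_iff.1 hsl with hτ | ⟨r, e, hr⟩
    · exact absurd (by simpa using hτ.subset) (ha s hs hsp)
    · exact ⟨Z, subset_rfl, hZ, r, hr, fun hu => absurd (by rw [e]) (hu s hs)⟩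

/-- Induction along proper extensions, with a fusion argument. If the claim failed for `σ`, the
previous lemma could be iterated to give `x₀ < x₁ < …` with sublists `τₙ` of `σ`. Since `σ` has
finitely many sublists, one `τ₀` occurs infinitely often, and the corresponding `xₙ` form a set for
which `σ` does dominate `τ₀`. -/
theorem exists_dominates (hwf : WellFounded (ProperExt E)) (σ : List ℕ)
    (hσ : σ.Pairwise (· > ·)) (ha : Avoids E σ) (X : Set ℕ) (hX : X.Infinite) :
    ∃ Y ⊆ X, Y.Infinite ∧ ∃ τ, τ.Sublist σ ∧ Dominates E Y σ τ := by
  induction σ using hwf.induction generalizing X with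
  | _ σ ih =>
  by_contra hne
  have hne : ∀ Y ⊆ X, Y.Infinite → ∀ τ, τ.Sublist σ → ¬Dominates E Y σ τ :=
    fun Y h1 h2 τ h3 h4 => hne ⟨Y, h1, h2, τ, h3, h4⟩
  have step : ∀ Z : {Z : Set ℕ // Z ⊆ X ∧ Z.Infinite}, ∃ x ∈ Z.1, ∃ Y ⊆ Z.1, Y.Infinite ∧
      ∃ τ, τ.Sublist σ ∧
        (Unsecured E (x :: τ) → ∃ σ', ProperExt E σ' σ ∧ Dominates E Y σ' (x :: τ)) := fun Z =>
    exists_cons_dominates hσ ha (fun σ' h X hX => ih σ' h h.1 h.2.1 X hX) Z.2.2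
      fun Y hY => hne Y (hY.trans Z.2.1)
  choose x hxZ Y hYZ hY τ hτ hd using step
  -- Shrinking to the part of `Y Z` above `x Z` makes the chosen points increase and places all
  -- later ones in `Y Z`.
  let next : {Z : Set ℕ // Z ⊆ X ∧ Z.Infinite} → {Z : Set ℕ // Z ⊆ X ∧ Z.Infinite} := fun Z =>
    ⟨Y Z \ Set.Iic (x Z), Set.sdiff_subset.trans ((hYZ Z).trans Z.2.1),
      (hY Z).sdiff (Set.finite_Iic _)⟩
  let S : ℕ → {Z : Set ℕ // Z ⊆ X ∧ Z.Infinite} := fun n => next^[n] ⟨X, subset_rfl, hX⟩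
  have hS : ∀ n, S (n + 1) = next (S n) := fun n => Function.iterate_succ_apply' _ _ _
  have hanti : ∀ n m, n ≤ m → (S m).1 ⊆ (S n).1 := fun n m hnm => by
    induction m, hnm using Nat.le_induction with
    | base => exact subset_rfl
    | succ m _ ih =>
      rw [hS]
      exact (Set.sdiff_subset.trans (hYZ _)).trans ih
  have hmem : ∀ n m, n < m → x (S m) ∈ Y (S n) \ Set.Iic (x (S n)) := fun n m hnm => by
    have := hanti _ _ hnm (hxZ (S m))
    rwa [Nat.succ_eq_add_one, hS] at this
  have hlt : StrictMono fun n => x (S n) := fun n m hnm => by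
    simpa using (hmem n m hnm).2
  have hfin : Finite {τ : List ℕ // τ.Sublist σ} := by
    have := (List.finite_toSet σ.sublists).to_subtype
    exact Finite.of_injective (β := {τ // τ ∈ σ.sublists})
      (fun τ => ⟨τ.1, List.mem_sublists.2 τ.2⟩) fun a b h => Subtype.ext (by simpa using h)
  obtain ⟨⟨τ₀, hτ₀⟩, hinf⟩ := Finite.exists_infinite_fiber
    fun n => (⟨τ (S n), hτ (S n)⟩ : {τ : List ℕ // τ.Sublist σ})
  let I : Set ℕ := {n | τ (S n) = τ₀}
  have hI : I.Infinite := by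
    rw [← Set.infinite_coe_iff]
    convert hinf using 2
    ext n
    simp [I]
  refine hne ((fun n => x (S n)) '' I) ?_ (hI.image hlt.injective.injOn) τ₀ hτ₀ ?_
  · rintro _ ⟨n, -, rfl⟩
    exact (S n).2.1 (hxZ (S n))
  · refine Dominates.intro ?_
    rintro _ ⟨n, hn, rfl⟩ hb hu
    have hn : τ (S n) = τ₀ := hn
    obtain ⟨σ', hσ', hd⟩ := hd (S n) (by rwa [hn])
    rw [hn] at hd
    refine ⟨σ', hσ', hd.mono ?_⟩
    -- Only points above `x (S n)` matter here; they were chosen after stage `n` and hence lie in `Y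
    -- (S n)`.
    rintro _ ⟨m, hm, rfl⟩ hc
    exact (hmem n m (hlt.lt_iff_lt.1 (hc _ List.mem_cons_self))).1

/-- If no infinite set avoids `E`, there are an infinite set and a monotone map from its tree of
unsecured finite subsets to the tree of proper extensions. -/
theorem exists_certificate (hwf : WellFounded (ProperExt E)) :
    ∃ (f : Baire) (ρ : List ℕ → List ℕ), StrictMono f ∧ ∀ a t, (a :: t).Pairwise (· > ·) →
      (∀ d ∈ a :: t, d ∈ Set.range f) → Unsecured E (a :: t) →
      ProperExt E (ρ (a :: t)) (ρ t) := by
  classical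
  -- If the empty string is in `E`, no list is unsecured and the condition is void. Otherwise the
  -- empty list avoids `E`, and the induction can start there.
  by_cases h0 : [] ∈ E
  · exact ⟨id, id, strictMono_id, fun a t _ _ hu => absurd (List.nil_suffix) (hu [] h0)⟩
  have hnil : Avoids E [] := fun s hs _ hsub => h0 (List.subset_nil.1 hsub ▸ hs)
  obtain ⟨Y, -, hY, τ, hτ, hd⟩ :=
    exists_dominates hwf [] List.Pairwise.nil hnil Set.univ Set.infinite_univ
  obtain rfl := List.sublist_nil.1 hτ
  have := hY.to_subtype
  -- The witnesses of domination are chosen by recursion along `t`; the default `[]` is not taken on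
  -- unsecured decreasing lists from `Y`.
  let ρ : List ℕ → List ℕ := fun t => List.rec [] (fun a t ih =>
    if h : ∃ σ', ProperExt E σ' ih ∧ Dominates E Y σ' (a :: t) then h.choose else []) t
  have hρ : ∀ a t, (∃ σ', ProperExt E σ' (ρ t) ∧ Dominates E Y σ' (a :: t)) →
      ProperExt E (ρ (a :: t)) (ρ t) ∧ Dominates E Y (ρ (a :: t)) (a :: t) := fun a t h => by
    have : ρ (a :: t) = h.choose := dif_pos h
    rw [this]
    exact h.choose_spec
  have key : ∀ t : List ℕ, t.Pairwise (· > ·) → (∀ d ∈ t, d ∈ Y) → Unsecured E t →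
      Dominates E Y (ρ t) t := fun t => by
    induction t with
    | nil => exact fun _ _ _ => hd
    | cons a t ih =>
      intro hp hm hu
      obtain ⟨hp1, hp2⟩ := List.pairwise_cons.1 hp
      refine (hρ a t ((ih hp2 (fun d hd => hm d (List.mem_cons_of_mem _ hd)) fun s hs h =>
        hu s hs (h.trans (List.suffix_cons _ _))).elim (hm a List.mem_cons_self) hp1 hu)).2
  refine ⟨Nat.orderEmbeddingOfSet Y, ρ, (Nat.orderEmbeddingOfSet Y).strictMono, ?_⟩
  intro a t hp hm hu
  rw [Nat.orderEmbeddingOfSet_range] at hm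
  obtain ⟨hp1, hp2⟩ := List.pairwise_cons.1 hp
  exact (hρ a t ((key t hp2 (fun d hd => hm d (List.mem_cons_of_mem _ hd)) fun s hs h =>
    hu s hs (h.trans (List.suffix_cons _ _))).elim (hm a List.mem_cons_self) hp1 hu)).1

/-! ### Homogeneity from certificates and from free sequences -/

theorem isPrefix_iff (s : List ℕ) (x : Baire) :
    IsPrefix s x ↔ ∃ n, (List.range n).map x = s := by
  constructor
  · intro h
    refine ⟨s.length, List.ext_getElem (by simp) fun i _ hi => by simp [h i hi]⟩
  · rintro ⟨n, rfl⟩ k hk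
    simp

/-- Otherwise all initial segments of `f ∘ g` are unsecured, and `ρ` maps them to an infinite chain
of proper extensions. -/
theorem exists_isPrefix_of_certificate (hwf : WellFounded (ProperExt E)) {f g : Baire}
    {ρ : List ℕ → List ℕ} (hf : StrictMono f) (hg : StrictMono g)
    (h : ∀ a t, (a :: t).Pairwise (· > ·) → (∀ d ∈ a :: t, d ∈ Set.range f) →
      Unsecured E (a :: t) → ProperExt E (ρ (a :: t)) (ρ t)) :
    ∃ s ∈ E, IsPrefix s fun n => f (g n) := by
  by_contra hne
  push Not at hne
  let t : ℕ → List ℕ := fun n => ((List.range n).map fun n => f (g n)).reverse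
  have ht : ∀ n, t (n + 1) = f (g n) :: t n := fun n => by simp [t, List.range_succ]
  rw [wellFounded_iff_isEmpty_descending_chain] at hwf
  refine hwf.false ⟨fun n => ρ (t n), fun n => ?_⟩
  change ProperExt E (ρ (t (n + 1))) (ρ (t n))
  rw [ht]
  refine h _ _ ?_ ?_ ?_
  · rw [← ht, List.pairwise_reverse, List.pairwise_map]
    exact List.pairwise_lt_range.imp fun h => hf (hg h)
  · rw [← ht]
    intro d hd
    simp only [t, List.mem_reverse, List.mem_map] at hd
    obtain ⟨k, -, rfl⟩ := hd
    exact ⟨_, rfl⟩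
  · rw [← ht]
    intro s hs hsuf
    refine hne s hs fun k hk => ?_
    rw [(List.reverse_suffix.1 hsuf).getElem hk]
    simp

theorem freeOf_iff {f : Baire} (hf : StrictMono f) :
    FreeOf E f ↔ ∀ g : Baire, StrictMono g → ¬∃ s ∈ E, IsPrefix s fun n => f (g n) := by
  constructor
  · rintro h g hg ⟨s, hs, hp⟩
    obtain ⟨n, rfl⟩ := (isPrefix_iff _ _).1 hp
    refine h _ hs ?_ ?_
    · rw [List.pairwise_map]
      exact List.pairwise_lt_range.imp fun h => hf (hg h)
    · intro a ha
      obtain ⟨k, -, rfl⟩ := List.mem_map.1 ha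
      exact ⟨_, rfl⟩
  · intro h s hs hp hr
    have : ∀ i : Fin s.length, ∃ k, f k = s[i] := fun i => hr _ (List.getElem_mem _)
    choose k hk using this
    have hle : ∀ i, k i ≤ s.sum := fun i =>
      (hf.le_apply.trans (hk i).le).trans (List.le_sum_of_mem (List.getElem_mem _))
    have hkm : StrictMono k := fun i j hij => by
      rw [← hf.lt_iff_lt, hk, hk]
      exact List.pairwise_iff_getElem.1 hp _ _ _ _ hij
    -- The positions of the entries of `s` in `f` are at most `s.sum`, so continuing from `s.sum +
    -- 1` keeps the sequence increasing.
    refine h (fun n => if h : n < s.length then k ⟨n, h⟩ else s.sum + 1 + n) ?_ ⟨s, hs, ?_⟩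
    · intro a b hab
      dsimp only
      split_ifs with h1 h2 h2
      · exact hkm hab
      · have := hle ⟨a, h1⟩
        omega
      · omega
      · omega
    · intro i hi
      simp [hi, hk]

end Combinatorics

/-! ### Names of sets and of finite sequences -/

section Names

open Encodable

/-- The strings that are enumerated by a name of an open set. -/
def stringsOf (p : Baire) : Set (List ℕ) := {s | ∃ m, p m = encode s + 1}

theorem mem_enumerated_iff {S : Set Baire} {p : Baire} {x : S} :
    x ∈ enumerated S p ↔ ∃ s ∈ stringsOf p, IsPrefix s x :=
  ⟨fun ⟨i, s, hi, hs⟩ => ⟨s, ⟨i, hi⟩, hs⟩, fun ⟨s, ⟨i, hi⟩, hs⟩ => ⟨i, s, hi, hs⟩⟩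

open Classical in
/-- A name which enumerates the strings of `B`. -/
noncomputable def nameOf (B : Set (List ℕ)) : Baire := fun k =>
  if ∃ σ, encode σ = k ∧ σ ∈ B then k + 1 else 0

theorem stringsOf_nameOf (B : Set (List ℕ)) : stringsOf (nameOf B) = B := by
  ext s
  simp only [stringsOf, nameOf, Set.mem_ofPred_eq]
  constructor
  · rintro ⟨m, hm⟩
    split_ifs at hm with h
    · obtain ⟨σ, rfl, hσ⟩ := h
      rwa [← encode_injective (Nat.succ_injective hm)]
  · exact fun h => ⟨encode s, if_pos ⟨s, rfl, h⟩⟩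

theorem isOpen_setOf_exists_isPrefix (B : Set (List ℕ)) :
    IsOpen {x : Baire | ∃ s ∈ B, IsPrefix s x} := by
  refine isOpen_iff_mem_nhds.2 ?_
  rintro x ⟨s, hs, hx⟩
  have : ∀ᶠ y in 𝓝 x, ∀ k ∈ Finset.range s.length, y k = x k :=
    (Filter.eventually_all_finset _).2 fun k _ => by
      have := (continuous_apply (A := fun _ : ℕ => ℕ) k).tendsto x
      rwa [nhds_discrete ℕ, tendsto_pure] at this
  filter_upwards [this] with y hy
  exact ⟨s, hs, fun k hk => (hx k hk).trans (hy k (Finset.mem_range.2 hk)).symm⟩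

/-- The open set generated by `B`. -/
def openOf (S : Set Baire) (B : Set (List ℕ)) : TopologicalSpace.Opens S :=
  ⟨{x | ∃ s ∈ B, IsPrefix s x}, (isOpen_setOf_exists_isPrefix B).preimage continuous_subtype_val⟩

/-- The closed set of all sequences without prefix in `B`. -/
def closedOf (B : Set (List ℕ)) : TopologicalSpace.Closeds Baire :=
  ⟨{x | ∃ s ∈ B, IsPrefix s x}ᶜ, (isOpen_setOf_exists_isPrefix B).isClosed_compl⟩

theorem mem_openOf {S : Set Baire} {B : Set (List ℕ)} {x : S} :
    x ∈ openOf S B ↔ ∃ s ∈ B, IsPrefix s x := Iff.rfl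

theorem mem_closedOf {B : Set (List ℕ)} {x : Baire} :
    x ∈ closedOf B ↔ ¬∃ s ∈ B, IsPrefix s x := Iff.rfl

theorem openRep_nameOf (S : Set Baire) (B : Set (List ℕ)) :
    (openRep S).Names (nameOf B) (openOf S B) := by
  refine Set.ext fun x => ?_
  rw [mem_enumerated_iff, stringsOf_nameOf]
  rfl

theorem closedRep_nameOf (B : Set (List ℕ)) : closedRep.Names (nameOf B) (closedOf B) := by
  intro x
  rw [mem_enumerated_iff, stringsOf_nameOf]
  rfl

theorem mem_iff_of_openRep {S : Set Baire} {p : Baire} {U : TopologicalSpace.Opens S}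
    (h : (openRep S).Names p U) (x : S) : x ∈ U ↔ ∃ s ∈ stringsOf p, IsPrefix s x := by
  rw [← mem_enumerated_iff, ← SetLike.mem_coe, ← show enumerated S p = U from h]

theorem mem_iff_of_closedRep {p : Baire} {A : TopologicalSpace.Closeds Baire}
    (h : closedRep.Names p A) (x : Baire) : x ∈ A ↔ ¬∃ s ∈ stringsOf p, IsPrefix s x := by
  rw [h x, mem_enumerated_iff]

/-- The name of the `i`-th entry of a finite sequence. -/
def entry (p : Baire) (i : ℕ) : Baire := component (fun m => p (m + 1)) i

/-- The name of a finite sequence of length `n` whose `i`-th entry has the name `φ i`. -/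
def seqName (n : ℕ) (φ : ℕ → Baire) : Baire := fun m =>
  if m = 0 then n else φ m.pred.unpair.1 m.pred.unpair.2

@[simp] theorem entry_seqName (n : ℕ) (φ : ℕ → Baire) (i : ℕ) : entry (seqName n φ) i = φ i := by
  funext k
  simp [entry, seqName, component]

theorem limComputable_seqName {N : Baire → ℕ} {φ : Baire → ℕ → Baire}
    (hN : ArithFun fun O (_ : ℕ) => N O) (hφ : ArithFun fun O (x : ℕ × ℕ) => φ O x.1 x.2) :
    LimComputable fun O => seqName (N O) (φ O) := by
  have h : ArithFun fun O m => if m = 0 then N O else φ O m.pred.unpair.1 m.pred.unpair.2 := by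
    convert! ArithFun.ite
      (ArithPred.of_primrecPred (Primrec.eq.comp Primrec.id (Primrec.const 0))) hN
      (hφ.comp (ArithFun.of_primrec (Primrec.unpair.comp Primrec.pred)))
  exact h.limComputable

end Names

/-- If every instance of `f` is solved arithmetically from the solutions of `c` instances of `g`,
then `f*` is arithmetically reducible to `g*`. -/
theorem ArithReducible.star_of {f g : Problem} (c : ℕ) {φ ψ : Baire → ℕ → Baire}
    (hφ : ArithFun fun O (x : ℕ × ℕ) => φ O x.1 x.2)
    (hψ : ArithFun fun O (x : ℕ × ℕ) => ψ O x.1 x.2)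
    (h : ∀ p i x, f.inRep.Names (entry p i) x → x ∈ f.dom → ∃ z : Fin c → g.In,
      (∀ j, z j ∈ g.dom) ∧ (∀ j : Fin c, g.inRep.Names (φ p (j + c * i)) (z j)) ∧
      ∀ b, (∀ j : Fin c, ∃ y ∈ g.sol (z j), g.outRep.Names (entry b (j + c * i)) y) →
        ∃ y ∈ f.sol x, f.outRep.Names (ψ (join p b) i) y) :
    ArithReducible f.star g.star := by
  have h0 : ArithFun fun (O : Baire) (_ : ℕ) => O 0 :=
    ArithFun.query (ArithFun.of_primrec (Primrec.const 0))
  refine ⟨_, _, (limComputable_seqName (N := fun O => O 0 * c)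
    (h0.prim (Primrec.nat_mul.comp Primrec.id (Primrec.const c))) hφ).arithmetic,
    (limComputable_seqName h0 hψ).arithmetic, fun G hG => ?_⟩
  rintro p (l : List f.In) ⟨hp0, hp⟩ ⟨(m : List f.Out), hm⟩
  obtain ⟨hlm, hm⟩ := List.forall₂_iff_get.1 hm
  have hz := fun i : Fin l.length => h p i l[i] (hp i i.2) ⟨_, hm i i.2 (hlm ▸ i.2)⟩
  choose z hzd hzn hzs using hz
  -- Entry `i` owns the block of positions `j + c * i` with `j < c`.
  let L : List g.In := List.ofFn fun j : Fin (l.length * c) => z j.divNat j.modNat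
  have hL : g.star.inRep.Names (seqName (p 0 * c) (φ p)) L := by
    refine ⟨by simp [L, seqName, hp0], fun i hi => ?_⟩
    change g.inRep.Names (entry _ i) _
    rw [entry_seqName]
    have hi' : i < l.length * c := by simpa [L] using hi
    have := hzn (Fin.divNat ⟨i, hi'⟩) (Fin.modNat ⟨i, hi'⟩)
    simpa [L, Nat.mod_add_div] using this
  have hLd : L ∈ g.star.dom := by
    choose s hs using hzd
    refine ⟨List.ofFn fun j : Fin (l.length * c) => s j.divNat j.modNat, ?_⟩
    refine List.forall₂_iff_get.2 ⟨by simp [L], fun i h1 h2 => ?_⟩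
    simpa [L] using hs _ _
  obtain ⟨q, hq, (M : List g.Out), hM, hqM⟩ := hG _ L hL hLd
  obtain ⟨hq0, hq1⟩ := hqM
  obtain ⟨hLM, hM⟩ := List.forall₂_iff_get.1 hM
  have hy := fun i => hzs i q fun j => by
    have hlt : (j : ℕ) + c * i < l.length * c := by
      calc (j : ℕ) + c * i < c + c * i := by omega
        _ = c * (i + 1) := by ring
        _ ≤ c * l.length := Nat.mul_le_mul_left _ i.2
        _ = l.length * c := mul_comm _ _
    have hL1 : (j : ℕ) + c * i < L.length := by simpa [L] using hlt
    have hc : 0 < c := j.pos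
    have hLj : L.get ⟨_, hL1⟩ = z i j := by
      simp only [L, List.get_ofFn]
      congr 1
      · exact Fin.ext (by simp [Nat.add_mul_div_left _ _ hc, Nat.div_eq_of_lt j.2])
      · exact Fin.ext (by simp [Nat.mod_eq_of_lt j.2])
    refine ⟨_, hLj ▸ hM _ hL1 (hLM ▸ hL1), hq1 _ _⟩
  choose y hy hyn using hy
  refine ⟨seqName (p 0) (ψ (join p q)), ?_, List.ofFn y, ?_, ?_⟩
  · exact Part.mem_bind (Part.mem_some _) (Part.mem_bind hq (Part.mem_some _))
  · refine List.forall₂_iff_get.2 ⟨by simp, fun i h1 h2 => ?_⟩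
    simpa using hy ⟨i, h1⟩
  · refine ⟨by simp [seqName, hp0], fun i hi => ?_⟩
    change f.outRep.Names (entry _ i) _
    rw [entry_seqName]
    simpa using hyn ⟨i, by simpa using hi⟩

/-! ### Arithmetical predicates on strings -/

section Strings

open Encodable

variable {α γ : Type} [Primcodable α] [Primcodable γ]

theorem ArithFun.lift {β : Type} [Primcodable β] {F : Baire → α → β} (hF : ArithFun F) :
    ArithFun fun O (x : α × γ) => F O x.1 :=
  hF.comp (of_primrec Primrec.fst)

theorem ArithFun.var : ArithFun fun _ (x : α × γ) => x.2 := of_primrec Primrec.snd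

theorem ArithFun.const {β : Type} [Primcodable β] (b : β) : ArithFun fun _ (_ : α) => b :=
  of_primrec (Primrec.const b)

/-- Arithmetical families of sets of strings. -/
def ArithSet (E : Baire → α → Set (List ℕ)) : Prop :=
  ArithPred fun O (x : α × List ℕ) => x.2 ∈ E O x.1

/-- Arithmetical families of points of Baire space. -/
def ArithSeq (f : Baire → α → Baire) : Prop := ArithFun fun O (x : α × ℕ) => f O x.1 x.2

theorem ArithSet.mem {E : Baire → α → Set (List ℕ)} (hE : ArithSet E) {σ : Baire → α → List ℕ}
    (hσ : ArithFun σ) : ArithPred fun O a => σ O a ∈ E O a :=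
  ArithPred.comp hE ((ArithFun.of_primrec Primrec.id).pair hσ)

theorem ArithSet.subst {E : Baire → α → Set (List ℕ)} (hE : ArithSet E) {F : Baire → γ → α}
    (hF : ArithFun F) : ArithSet fun O c => E O (F O c) :=
  ArithPred.comp hE (hF.lift.pair ArithFun.var)

theorem ArithSet.lift {E : Baire → α → Set (List ℕ)} (hE : ArithSet E) :
    ArithSet fun O (x : α × γ) => E O x.1 :=
  hE.subst (ArithFun.of_primrec Primrec.fst)

theorem ArithSeq.app {f : Baire → α → Baire} (hf : ArithSeq f) {F : Baire → α → ℕ}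
    (hF : ArithFun F) : ArithFun fun O a => f O a (F O a) :=
  ArithFun.comp hf ((ArithFun.of_primrec Primrec.id).pair hF)

theorem ArithSeq.subst {f : Baire → α → Baire} (hf : ArithSeq f) {F : Baire → γ → α}
    (hF : ArithFun F) : ArithSeq fun O c => f O (F O c) :=
  ArithFun.comp hf (hF.lift.pair ArithFun.var)

theorem ArithSeq.lift {f : Baire → α → Baire} (hf : ArithSeq f) :
    ArithSeq fun O (x : α × γ) => f O x.1 :=
  hf.subst (ArithFun.of_primrec Primrec.fst)

theorem arithSet_entry {i : Baire → α → ℕ} (hi : ArithFun i) :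
    ArithSet fun O a => stringsOf (entry O (i O a)) := by
  refine ArithPred.ex (R := fun O (x : α × List ℕ) m =>
    O (Nat.pair (i O x.1) m + 1) = encode x.2 + 1)
    (ArithPred.eq (ArithFun.query (ArithFun.prim Primrec.succ
      (ArithFun.prim₂ Primrec₂.natPair hi.lift.lift ArithFun.var)))
      (ArithFun.prim Primrec.succ (ArithFun.prim Primrec.encode ArithFun.var.lift)))

theorem arithSeq_entry {i : Baire → α → ℕ} (hi : ArithFun i) :
    ArithSeq fun O a => entry O (i O a) :=
  ArithFun.query (ArithFun.prim Primrec.succ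
      (ArithFun.prim₂ Primrec₂.natPair hi.lift ArithFun.var))

theorem arithSeq_nameOf {B : Baire → α → Set (List ℕ)} (hB : ArithSet B) :
    ArithSeq fun O a => nameOf (B O a) := by
  have := ArithFun.ite (ArithPred.ex (R := fun O (x : α × ℕ) σ => encode σ = x.2 ∧ σ ∈ B O x.1)
    ((ArithPred.eq (ArithFun.prim Primrec.encode ArithFun.var) ArithFun.var.lift).and
      (hB.lift.lift.mem ArithFun.var))) (ArithFun.var.prim Primrec.succ) (ArithFun.const 0)
  exact this

namespace ArithPred

variable {s t : Baire → α → List ℕ} {a : Baire → α → ℕ}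

theorem getElem? {i : Baire → α → ℕ} (hs : ArithFun s) (hi : ArithFun i) (ha : ArithFun a) :
    ArithPred fun O x => (s O x)[i O x]? = some (a O x) :=
  eq (ArithFun.prim₂ Primrec.list_getElem? hs hi) (ArithFun.prim Primrec.option_some ha)

theorem mem (ha : ArithFun a) (hs : ArithFun s) : ArithPred fun O x => a O x ∈ s O x :=
  (ex (R := fun O x k => (s O x)[k]? = some (a O x))
    (getElem? hs.lift ArithFun.var ha.lift)).of_iff fun _ _ => List.mem_iff_getElem?

theorem subset (hs : ArithFun s) (ht : ArithFun t) : ArithPred fun O x => s O x ⊆ t O x :=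
  all (R := fun O x c => c ∈ s O x → c ∈ t O x)
    ((mem ArithFun.var hs.lift).imp (mem ArithFun.var ht.lift))

theorem isPrefix (hs : ArithFun s) (ht : ArithFun t) : ArithPred fun O x => s O x <+: t O x :=
  ex (R := fun O x u => s O x ++ u = t O x)
    (eq (ArithFun.prim₂ Primrec.list_append hs.lift ArithFun.var) ht.lift)

theorem isSuffix (hs : ArithFun s) (ht : ArithFun t) : ArithPred fun O x => s O x <:+ t O x :=
  ex (R := fun O x u => u ++ s O x = t O x)
    (eq (ArithFun.prim₂ Primrec.list_append ArithFun.var hs.lift) ht.lift)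

/-- By transitivity it suffices to compare neighbouring entries, which takes number quantifiers
only. -/
theorem pairwise_lt (hs : ArithFun s) : ArithPred fun O x => (s O x).Pairwise (· < ·) := by
  have h : ArithPred fun O x => ∀ i b c, (s O x)[i]? = some b → (s O x)[i + 1]? = some c → b < c :=
    all (all (all ((getElem? hs.lift.lift.lift ArithFun.var.lift.lift ArithFun.var.lift).imp
      ((getElem? hs.lift.lift.lift (ArithFun.prim Primrec.succ ArithFun.var.lift.lift)
        ArithFun.var).imp (lt ArithFun.var.lift ArithFun.var)))))
  refine h.of_iff fun O x => ?_
  rw [← List.isChain_iff_pairwise, List.isChain_iff_getElem]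
  constructor
  · intro h i b c hb hc
    obtain ⟨h1, rfl⟩ := List.getElem?_eq_some_iff.1 hb
    obtain ⟨h2, rfl⟩ := List.getElem?_eq_some_iff.1 hc
    exact h i h2
  · intro h i hi
    exact h i _ _ (List.getElem?_eq_getElem _) (List.getElem?_eq_getElem _)

theorem pairwise_gt (hs : ArithFun s) : ArithPred fun O x => (s O x).Pairwise (· > ·) :=
  (pairwise_lt (ArithFun.prim Primrec.list_reverse hs)).of_iff fun _ _ => by
    rw [List.pairwise_reverse]

variable {E : Baire → α → Set (List ℕ)}

theorem avoids (hE : ArithSet E) (hs : ArithFun s) : ArithPred fun O x => Avoids (E O x) (s O x) :=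
  all (R := fun O x u => u ∈ E O x → u.Pairwise (· < ·) → ¬u ⊆ s O x)
    ((hE.lift.mem ArithFun.var).imp ((pairwise_lt ArithFun.var).imp
      (subset ArithFun.var hs.lift).not))

theorem properExt (hE : ArithSet E) (hs : ArithFun s) (ht : ArithFun t) :
    ArithPred fun O x => ProperExt (E O x) (s O x) (t O x) :=
  (pairwise_gt hs).and ((avoids hE hs).and
    (ex (R := fun O x u => u ≠ [] ∧ s O x = u ++ t O x)
      ((eq ArithFun.var (ArithFun.const [])).not.and
        (eq hs.lift (ArithFun.prim₂ Primrec.list_append ArithFun.var ht.lift)))))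

theorem unsecured (hE : ArithSet E) (hs : ArithFun s) :
    ArithPred fun O x => Unsecured (E O x) (s O x) :=
  all (R := fun O x u => u ∈ E O x → ¬u.reverse <:+ s O x)
    ((hE.lift.mem ArithFun.var).imp
      (isSuffix (ArithFun.prim Primrec.list_reverse ArithFun.var) hs.lift).not)

theorem strictMono {f : Baire → α → Baire} (hf : ArithSeq f) :
    ArithPred fun O x => StrictMono (f O x) :=
  (all (R := fun O x k => f O x k < f O x (k + 1))
    (lt (hf.lift.app ArithFun.var) (hf.lift.app (ArithFun.prim Primrec.succ ArithFun.var)))).of_iff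
    fun _ _ => ⟨fun h _ => h (Nat.lt_succ_self _), strictMono_nat_of_lt_succ⟩

theorem freeOf {f : Baire → α → Baire} (hE : ArithSet E) (hf : ArithSeq f) :
    ArithPred fun O x => FreeOf (E O x) (f O x) :=
  all (R := fun O x u => u ∈ E O x → u.Pairwise (· < ·) → ¬∀ a ∈ u, a ∈ Set.range (f O x))
    ((hE.lift.mem ArithFun.var).imp ((pairwise_lt ArithFun.var).imp
      (all
        ((mem ArithFun.var ArithFun.var.lift).imp
          (ex (R := fun O (x : (α × List ℕ) × ℕ) k => f O x.1.1 k = x.2)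
            (eq (hf.lift.lift.lift.app ArithFun.var) ArithFun.var.lift)))).not))

end ArithPred

end Strings

/-! ### The open Ramsey theorem is reducible to total choice -/

section RamseyToChoice

open Encodable

theorem IsPrefix.eq_of_getElem? {σ : List ℕ} {x : Baire} (h : IsPrefix σ x) {k b : ℕ}
    (hk : σ[k]? = some b) : b = x k := by
  obtain ⟨hlt, rfl⟩ := List.getElem?_eq_some_iff.1 hk
  exact h k hlt

theorem isPrefix_map_range (x : Baire) (n : ℕ) : IsPrefix ((List.range n).map x) x :=
  (isPrefix_iff _ _).2 ⟨n, rfl⟩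

theorem getElem?_map_range (x : Baire) {k n : ℕ} (h : k < n) :
    ((List.range n).map x)[k]? = some (x k) := by
  simp [h]

/-- The strings without increasing extension that avoids `E`. -/
def notFree (E : Set (List ℕ)) : Set (List ℕ) := {σ | ¬(σ.Pairwise (· < ·) ∧ Avoids E σ)}

/-- A failure of monotonicity or freeness shows in a finite prefix, so the free sequences form a
closed set. -/
theorem exists_notFree_isPrefix_iff {E : Set (List ℕ)} {x : Baire} :
    (¬∃ σ ∈ notFree E, IsPrefix σ x) ↔ StrictMono x ∧ FreeOf E x := by
  constructor
  · intro h
    have h : ∀ n, ((List.range n).map x).Pairwise (· < ·) ∧ Avoids E ((List.range n).map x) :=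
      fun n => by_contra fun hn => h ⟨_, hn, isPrefix_map_range x n⟩
    refine ⟨strictMono_nat_of_lt_succ fun n => ?_, fun s hs hp hr => ?_⟩
    · have := (h (n + 2)).1
      rw [List.pairwise_map] at this
      have := List.pairwise_iff_getElem.1 this n (n + 1) (by simp) (by simp) (by omega)
      simpa using this
    · choose! k hk using fun a ha => hr a ha
      refine (h ((s.map k).sum + 1)).2 s hs hp fun a ha => ?_
      refine List.mem_map.2 ⟨k a, List.mem_range.2 (Nat.lt_succ_of_le ?_), hk a ha⟩
      exact List.le_sum_of_mem (List.mem_map_of_mem ha)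
  · rintro ⟨hx, hf⟩ ⟨σ, hσ, hp⟩
    obtain ⟨n, rfl⟩ := (isPrefix_iff _ _).1 hp
    refine hσ ⟨?_, fun s hs hs' hsub => hf s hs hs' fun a ha => ?_⟩
    · rw [List.pairwise_map]
      exact List.pairwise_lt_range.imp fun h => hx h
    · obtain ⟨k, -, rfl⟩ := List.mem_map.1 (hsub ha)
      exact ⟨k, rfl⟩

/-- The string with a given code. -/
def decodeString (n : ℕ) : List ℕ := (decode n).getD []

/-- `x` codes a strictly increasing `f` together with a monotone map from the tree of unsecured
finite subsets of the range of `f` to the tree of strings that avoid `E`. -/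
def IsCertificate (E : Set (List ℕ)) (x : Baire) : Prop :=
  (StrictMono fun n => (x n).unpair.1) ∧ ∀ a t, (a :: t).Pairwise (· > ·) →
    (∀ d ∈ a :: t, d ∈ Set.range fun n => (x n).unpair.1) → Unsecured E (a :: t) →
    ProperExt E (decodeString (x (encode (a :: t))).unpair.2)
      (decodeString (x (encode t)).unpair.2)

/-- The strings that violate the conditions on a certificate. -/
def notCertificate (E : Set (List ℕ)) : Set (List ℕ) :=
  {σ | (∃ k b c, σ[k]? = some b ∧ σ[k + 1]? = some c ∧ c.unpair.1 ≤ b.unpair.1) ∨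
    ∃ a t b c, σ[encode t]? = some b ∧ σ[encode (a :: t)]? = some c ∧ (a :: t).Pairwise (· > ·) ∧
      (∀ d ∈ a :: t, ∃ e ∈ σ, e.unpair.1 = d) ∧ Unsecured E (a :: t) ∧
      ¬ProperExt E (decodeString c.unpair.2) (decodeString b.unpair.2)}

theorem exists_notCertificate_isPrefix_iff {E : Set (List ℕ)} {x : Baire} :
    (¬∃ σ ∈ notCertificate E, IsPrefix σ x) ↔ IsCertificate E x := by
  constructor
  · intro h
    refine ⟨strictMono_nat_of_lt_succ fun n => ?_, fun a t hp hr hu => ?_⟩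
    · by_contra hn
      exact h ⟨_, Or.inl ⟨n, _, _, getElem?_map_range x (by omega : n < n + 2),
        getElem?_map_range x (by omega), not_lt.1 hn⟩, isPrefix_map_range x (n + 2)⟩
    · by_contra hn
      choose! k hk using fun d hd => hr d hd
      -- A prefix of this length contains the values at `t` and `a :: t` as well as positions `k d`
      -- showing that the entries of `a :: t` are in the range.
      let n := encode t + encode (a :: t) + ((a :: t).map k).sum + 1
      refine h ⟨_, Or.inr ⟨a, t, _, _, getElem?_map_range x (by omega : _ < n),
        getElem?_map_range x (by omega), hp, fun d hd => ?_, hu, hn⟩, isPrefix_map_range x n⟩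
      refine ⟨x (k d), List.mem_map.2 ⟨k d, List.mem_range.2 ?_, rfl⟩, hk d hd⟩
      have : k d ≤ ((a :: t).map k).sum := List.le_sum_of_mem (List.mem_map_of_mem hd)
      omega
  · rintro ⟨hf, hc⟩ ⟨σ, hσ, hp⟩
    rcases hσ with ⟨k, b, c, hb, hc, hle⟩ | ⟨a, t, b, c, hb, hc', hp', hd, hu, hn⟩
    · rw [hp.eq_of_getElem? hb, hp.eq_of_getElem? hc] at hle
      exact (hf (Nat.lt_succ_self k)).not_ge hle
    · rw [hp.eq_of_getElem? hb, hp.eq_of_getElem? hc'] at hn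
      refine hn (hc a t hp' (fun d hd' => ?_) hu)
      obtain ⟨e, he, rfl⟩ := hd d hd'
      obtain ⟨k, hk⟩ := List.mem_iff_getElem?.1 he
      exact ⟨k, congrArg (fun m => m.unpair.1) (hp.eq_of_getElem? hk).symm⟩

theorem exists_isCertificate {E : Set (List ℕ)} (hwf : WellFounded (ProperExt E)) :
    ∃ x, IsCertificate E x := by
  obtain ⟨f, ρ, hf, h⟩ := exists_certificate hwf
  have hdec : ∀ t : List ℕ, decodeString (encode t) = t := fun t => by simp [decodeString]
  refine ⟨fun n => Nat.pair (f n) (encode (ρ (decodeString n))), by simpa using hf, ?_⟩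
  intro a t hp hr hu
  simpa only [Nat.unpair_pair, hdec] using h a t hp (by simpa using hr) hu

/-! ### Arithmeticity of the two choice instances -/

section Arith

variable {α : Type} [Primcodable α] {E : Baire → α → Set (List ℕ)}

theorem ArithSet.notFree (hE : ArithSet E) : ArithSet fun O a => notFree (E O a) :=
  ((ArithPred.pairwise_lt ArithFun.var).and (ArithPred.avoids hE.lift ArithFun.var)).not

theorem ArithFun.decodeString {F : Baire → α → ℕ} (hF : ArithFun F) :
    ArithFun fun O a => decodeString (F O a) :=
  hF.prim (Primrec.option_getD.comp Primrec.decode (Primrec.const []))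

theorem ArithFun.fst_unpair {F : Baire → α → ℕ} (hF : ArithFun F) :
    ArithFun fun O a => (F O a).unpair.1 :=
  hF.prim (Primrec.fst.comp Primrec.unpair)

theorem ArithFun.snd_unpair {F : Baire → α → ℕ} (hF : ArithFun F) :
    ArithFun fun O a => (F O a).unpair.2 :=
  hF.prim (Primrec.snd.comp Primrec.unpair)

theorem ArithSet.notCertificate (hE : ArithSet E) :
    ArithSet fun O a => notCertificate (E O a) := by
  have h₁ : ArithPred fun O (x : α × List ℕ) => ∃ k b c, x.2[k]? = some b ∧ x.2[k + 1]? = some c ∧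
      c.unpair.1 ≤ b.unpair.1 := by
    refine .ex (.ex (.ex ?_))
    exact (ArithPred.getElem? ArithFun.var.lift.lift.lift ArithFun.var.lift.lift
      ArithFun.var.lift).and ((ArithPred.getElem? ArithFun.var.lift.lift.lift
        (ArithFun.prim Primrec.succ ArithFun.var.lift.lift) ArithFun.var).and
        (ArithPred.le ArithFun.var.fst_unpair ArithFun.var.lift.fst_unpair))
  have h₂ : ArithPred fun O (x : α × List ℕ) => ∃ a t b c, x.2[encode t]? = some b ∧
      x.2[encode (a :: t)]? = some c ∧ (a :: t).Pairwise (· > ·) ∧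
      (∀ d, d ∈ a :: t → ∃ e, e ∈ x.2 ∧ e.unpair.1 = d) ∧ Unsecured (E O x.1) (a :: t) ∧
      ¬ProperExt (E O x.1) (decodeString c.unpair.2) (decodeString b.unpair.2) := by
    refine .ex (.ex (.ex (.ex ?_)))
    have hσ : ArithFun fun _ (x : ((((α × List ℕ) × ℕ) × List ℕ) × ℕ) × ℕ) => x.1.1.1.1.2 :=
      ArithFun.var.lift.lift.lift.lift
    have ht : ArithFun fun _ (x : ((((α × List ℕ) × ℕ) × List ℕ) × ℕ) × ℕ) => x.1.1.2 :=
      ArithFun.var.lift.lift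
    have hat : ArithFun fun _ (x : ((((α × List ℕ) × ℕ) × List ℕ) × ℕ) × ℕ) =>
        x.1.1.1.2 :: x.1.1.2 :=
      ArithFun.prim₂ Primrec.list_cons ArithFun.var.lift.lift.lift ht
    have hE' : ArithSet fun O (x : ((((α × List ℕ) × ℕ) × List ℕ) × ℕ) × ℕ) => E O x.1.1.1.1.1 :=
      hE.lift.lift.lift.lift.lift
    refine (ArithPred.getElem? hσ (ht.prim Primrec.encode) ArithFun.var.lift).and
      ((ArithPred.getElem? hσ (hat.prim Primrec.encode) ArithFun.var).and
      ((ArithPred.pairwise_gt hat).and (ArithPred.and ?_ ((ArithPred.unsecured hE' hat).and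
        (ArithPred.properExt hE' ArithFun.var.snd_unpair.decodeString
          ArithFun.var.lift.snd_unpair.decodeString).not))))
    exact .all ((ArithPred.mem ArithFun.var hat.lift).imp (.ex
      ((ArithPred.mem ArithFun.var hσ.lift.lift).and
        (ArithPred.eq ArithFun.var.fst_unpair ArithFun.var.lift))))
  exact h₁.or h₂

end Arith

/-- The names of the two instances of choice for an open set. -/
noncomputable def choiceInstance (p : Baire) (j : ℕ) : Baire := fun k =>
  if j % 2 = 0 then nameOf (notFree (stringsOf (entry p (j / 2)))) k
  else nameOf (notCertificate (stringsOf (entry p (j / 2)))) k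

open Classical in
/-- The homogeneous set obtained from an open set and two choices. -/
noncomputable def homogeneousOf (r : Baire) (i : ℕ) : Baire := fun k =>
  -- The first choice is arbitrary if there is no free sequence, so its answer is verified, which is
  -- an arithmetical test.
  if StrictMono (entry (oddPart r) (2 * i)) ∧
    FreeOf (stringsOf (entry (evenPart r) i)) (entry (oddPart r) (2 * i))
  then entry (oddPart r) (2 * i) k else (entry (oddPart r) (2 * i + 1) k).unpair.1

theorem arithFun_choiceInstance :
    ArithFun fun O (x : ℕ × ℕ) => choiceInstance O x.1 x.2 := by
  have hE : ArithSet fun O (x : ℕ × ℕ) => stringsOf (entry O (x.1 / 2)) :=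
    arithSet_entry (ArithFun.of_primrec (Primrec.nat_div.comp Primrec.fst (Primrec.const 2)))
  unfold choiceInstance
  convert! ArithFun.ite (ArithPred.of_primrecPred (Primrec.eq.comp
    (Primrec.nat_mod.comp Primrec.fst (Primrec.const 2)) (Primrec.const 0)))
    ((arithSeq_nameOf hE.notFree).app ArithFun.var)
    ((arithSeq_nameOf hE.notCertificate).app ArithFun.var)

theorem arithFun_homogeneousOf :
    ArithFun fun O (x : ℕ × ℕ) => homogeneousOf O x.1 x.2 := by
  have hE : ArithSet fun O (x : ℕ × ℕ) => stringsOf (entry (evenPart O) x.1) :=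
    ArithPred.of_oracle (arithSet_entry (ArithFun.of_primrec Primrec.fst)) totalRec_evenPart
  have h0 : ArithSeq fun O (x : ℕ × ℕ) => entry (oddPart O) (2 * x.1) :=
    ArithFun.of_oracle (arithSeq_entry (ArithFun.of_primrec
      (Primrec.nat_double.comp Primrec.fst))) totalRec_oddPart
  have h1 : ArithSeq fun O (x : ℕ × ℕ) => entry (oddPart O) (2 * x.1 + 1) :=
    ArithFun.of_oracle (arithSeq_entry (ArithFun.of_primrec
      (Primrec.nat_double_succ.comp Primrec.fst))) totalRec_oddPart
  unfold homogeneousOf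
  convert! ArithFun.ite ((ArithPred.strictMono h0).and (ArithPred.freeOf hE h0))
    (h0.app ArithFun.var) (h1.app ArithFun.var).fst_unpair

/-! ### Correctness of the reduction to choice -/

theorem mem_dom_totalChoiceBaire (A : TopologicalSpace.Closeds Baire) :
    A ∈ totalChoiceBaire.dom := by
  by_cases h : ∃ x, x ∈ A
  · obtain ⟨x, hx⟩ := h
    exact ⟨x, fun _ => hx⟩
  · exact ⟨fun _ => 0, fun ⟨y, hy⟩ => absurd ⟨y, hy⟩ h⟩

theorem mem_of_mem_totalChoiceBaire_sol {A : TopologicalSpace.Closeds Baire} {x y : Baire}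
    (hx : x ∈ A) (hy : y ∈ totalChoiceBaire.sol A) : y ∈ A :=
  hy ⟨x, hx⟩

theorem openRT_star_reducible : ArithReducible openRT.star totalChoiceBaire.star := by
  refine ArithReducible.star_of 2 arithFun_choiceInstance arithFun_homogeneousOf ?_
  intro p i (P : TopologicalSpace.Opens Ramsey) hP _
  set E := stringsOf (entry p i) with hE
  have hmem := mem_iff_of_openRep hP
  refine ⟨![closedOf (notFree E), closedOf (notCertificate E)],
    fun _ => mem_dom_totalChoiceBaire _, fun j => ?_, fun b hb => ?_⟩
  · fin_cases j
    · have : choiceInstance p (0 + 2 * i) = nameOf (notFree E) := by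
        funext k
        simp [choiceInstance, hE]
      exact this ▸ closedRep_nameOf (notFree E)
    · have : choiceInstance p (1 + 2 * i) = nameOf (notCertificate E) := by
        have : (1 + 2 * i) / 2 = i := by omega
        funext k
        simp [choiceInstance, hE, this]
      exact this ▸ closedRep_nameOf (notCertificate E)
  · obtain ⟨_, hy₀, rfl⟩ := hb 0
    obtain ⟨_, hy₁, rfl⟩ := hb 1
    simp only [Fin.val_zero, Fin.val_one, zero_add, add_comm 1] at hy₀ hy₁
    by_cases h : StrictMono (entry b (2 * i)) ∧ FreeOf E (entry b (2 * i))
    · refine ⟨⟨entry b (2 * i), h.1⟩, Or.inr fun g hg => ?_, ?_⟩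
      · exact (freeOf_iff h.1).1 h.2 g g.2 ((hmem _).1 hg)
      · funext k
        simp [homogeneousOf, ← hE, h]
    -- Had there been a free sequence, the first choice would have returned one and passed the test.
    · have hfree : ∀ x : Baire, StrictMono x → ¬FreeOf E x := fun x hx hf => by
        refine h (exists_notFree_isPrefix_iff.1 (mem_closedOf.1
          (mem_of_mem_totalChoiceBaire_sol (x := x) ?_ hy₀)))
        exact mem_closedOf.2 (exists_notFree_isPrefix_iff.2 ⟨hx, hf⟩)
      have hwf := wellFounded_properExt hfree
      obtain ⟨x, hx⟩ := exists_isCertificate hwf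
      have hcert : IsCertificate E (entry b (2 * i + 1)) :=
        exists_notCertificate_isPrefix_iff.1 (mem_closedOf.1
          (mem_of_mem_totalChoiceBaire_sol
            (mem_closedOf.2 (exists_notCertificate_isPrefix_iff.2 hx)) hy₁))
      refine ⟨⟨_, hcert.1⟩, Or.inl fun g => ?_, ?_⟩
      · exact (hmem _).2 (exists_isPrefix_of_certificate hwf
          (f := fun n => (entry b (2 * i + 1) n).unpair.1) hcert.1 g.2
          (ρ := fun t => decodeString (entry b (2 * i + 1) (encode t)).unpair.2) hcert.2)
      · funext k
        simp [homogeneousOf, ← hE, h]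

end RamseyToChoice

/-! ### Total choice is reducible to the open Ramsey theorem -/

section ChoiceToRamsey

variable {E : Set (List ℕ)} {f : Baire}

/-- `u` is pointwise bounded by `f` and has no prefix in `E`. -/
def BoundedFree (E : Set (List ℕ)) (f : Baire) (u : List ℕ) : Prop :=
  (∀ k b, u[k]? = some b → b ≤ f k) ∧ ∀ s ∈ E, ¬s <+: u

/-- `u` has arbitrarily long bounded extensions without prefix in `E`. -/
def Extendible (E : Set (List ℕ)) (f : Baire) (u : List ℕ) : Prop :=
  ∀ m, ∃ w : List ℕ, w.length = m ∧ BoundedFree E f (u ++ w)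

/-- `u` is the leftmost extendible string of its length. -/
def Leftmost (E : Set (List ℕ)) (f : Baire) (u : List ℕ) : Prop :=
  ∀ v a w, u = v ++ a :: w → Extendible E f (v ++ [a]) ∧ ∀ b < a, ¬Extendible E f (v ++ [b])

/-- The leftmost infinite path that is bounded by `f` and has no prefix in `E`. -/
noncomputable def leftmostPath (E : Set (List ℕ)) (f : Baire) : Baire := fun k =>
  sInf {a | ∃ u : List ℕ, u.length = k ∧ Leftmost E f (u ++ [a])}

theorem BoundedFree.of_append {u w : List ℕ} (h : BoundedFree E f (u ++ w)) :
    BoundedFree E f u := by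
  refine ⟨fun k b hb => h.1 k b ?_, fun s hs hp => h.2 s hs (hp.trans (List.prefix_append _ _))⟩
  obtain ⟨hk, rfl⟩ := List.getElem?_eq_some_iff.1 hb
  rw [List.getElem?_append_left hk, hb]

theorem Extendible.boundedFree {u : List ℕ} (h : Extendible E f u) : BoundedFree E f u :=
  (h 0).elim fun _ hw => hw.2.of_append

/-- Kőnig's lemma: only the finitely many values up to `f u.length` can follow `u`, so they cannot
all be dead ends. -/
theorem Extendible.exists_append {u : List ℕ} (h : Extendible E f u) :
    ∃ a, Extendible E f (u ++ [a]) := by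
  by_contra hn
  simp only [Extendible, not_exists, not_forall] at hn
  choose m hm using hn
  -- Each `m a` is a length to which `u ++ [a]` does not extend. The extension taken exceeds all
  -- relevant `m a`, plus one for the entry `a` itself.
  obtain ⟨w, hw, hb⟩ := h ((Finset.range (f u.length + 1)).sup m + 1)
  obtain ⟨a, w, rfl⟩ := List.exists_cons_of_length_eq_add_one hw
  have ha : a ≤ f u.length := hb.1 u.length a (by simp)
  have hma : m a ≤ w.length := by
    rw [show w.length = _ from Nat.succ_injective hw]
    exact Finset.le_sup (Finset.mem_range.2 (Nat.lt_succ_of_le ha))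
  refine hm a (w.take (m a)) ⟨by simpa using hma, ?_⟩
  refine BoundedFree.of_append (w := w.drop (m a)) ?_
  simpa using hb

theorem Leftmost.of_append {u w : List ℕ} (h : Leftmost E f (u ++ w)) : Leftmost E f u := by
  rintro v a w' rfl
  exact h v a (w' ++ w) (by simp)

theorem Leftmost.extendible (h0 : Extendible E f []) {u : List ℕ} (h : Leftmost E f u) :
    Extendible E f u := by
  rcases List.eq_nil_or_concat u with rfl | ⟨v, a, rfl⟩
  · exact h0
  · simpa using (h v a [] (by simp)).1

theorem Leftmost.unique {u u' : List ℕ} (h : Leftmost E f u) (h' : Leftmost E f u')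
    (hl : u.length = u'.length) : u = u' := by
  induction u using List.reverseRecOn generalizing u' with
  | nil => exact (List.length_eq_zero_iff.1 hl.symm).symm
  | append_singleton v a ih =>
    rcases List.eq_nil_or_concat u' with rfl | ⟨v', a', rfl⟩
    · simp at hl
    · simp only [List.concat_eq_append] at *
      obtain rfl := ih h.of_append h'.of_append (by simpa using hl)
      have h1 := h v a [] rfl
      have h2 := h' v a' [] rfl
      rcases lt_trichotomy a a' with hlt | rfl | hlt
      · exact absurd h1.1 (h2.2 a hlt)
      · rfl
      · exact absurd h2.1 (h1.2 a' hlt)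

theorem Leftmost.exists_append (h0 : Extendible E f []) {u : List ℕ} (h : Leftmost E f u) :
    ∃ a, Leftmost E f (u ++ [a]) := by
  classical
  have hex := (h.extendible h0).exists_append
  refine ⟨Nat.find hex, fun v a w e => ?_⟩
  rcases List.eq_nil_or_concat w with rfl | ⟨w, c, rfl⟩
  · obtain ⟨rfl, e⟩ := List.append_inj' e rfl
    obtain rfl : Nat.find hex = a := by simpa using e
    exact ⟨Nat.find_spec hex, fun b hb => Nat.find_min hex hb⟩
  · have e' : u ++ [Nat.find hex] = (v ++ a :: w) ++ [c] := by simpa using e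
    exact h v a w (List.append_inj' e' rfl).1

theorem leftmost_leftmostPath (h0 : Extendible E f []) (n : ℕ) :
    Leftmost E f ((List.range n).map (leftmostPath E f)) := by
  induction n with
  | zero => exact fun v a w e => by simp at e
  | succ n ih =>
    obtain ⟨a, ha⟩ := ih.exists_append h0
    -- Leftmost strings of a given length are unique, so the infimum in `leftmostPath` is over a
    -- singleton.
    have : {a | ∃ u : List ℕ, u.length = n ∧ Leftmost E f (u ++ [a])} = {a} := by
      ext b
      constructor
      · rintro ⟨u, hu, hb⟩
        have := hb.unique ha (by simp [hu])
        simpa using (List.append_inj' this rfl).2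
      · rintro rfl
        exact ⟨_, by simp, ha⟩
    have hn : leftmostPath E f n = a := by
      rw [leftmostPath, this]
      exact csInf_singleton a
    simpa [List.range_succ, hn] using ha

theorem not_exists_isPrefix_leftmostPath (h0 : Extendible E f []) :
    ¬∃ s ∈ E, IsPrefix s (leftmostPath E f) := by
  rintro ⟨s, hs, hp⟩
  obtain ⟨n, rfl⟩ := (isPrefix_iff _ _).1 hp
  exact ((leftmost_leftmostPath h0 n).extendible h0).boundedFree.2 _ hs List.prefix_rfl

theorem extendible_nil_of_le {x : Baire} (hx : ¬∃ s ∈ E, IsPrefix s x) (h : ∀ n, x n ≤ f n) :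
    Extendible E f [] := by
  refine fun m => ⟨(List.range m).map x, by simp, fun k b hb => ?_, fun s hs hp => ?_⟩
  · rw [(isPrefix_map_range x m).eq_of_getElem? hb]
    exact h k
  · refine hx ⟨s, hs, fun k hk => ?_⟩
    rw [hp.getElem hk]
    simp

/-- The strings `σ` that bound no string of their length without prefix in `E`. -/
def notBounding (E : Set (List ℕ)) : Set (List ℕ) :=
  {σ | ¬∃ u : List ℕ, u.length = σ.length ∧
    (∀ k b c : ℕ, u[k]? = some b → σ[k]? = some c → b ≤ c) ∧ ∀ s ∈ E, ¬s <+: u}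

/-- A finite tree below `f` has an empty level, which is determined by a prefix of `f`; this makes
the Ramsey instance open. -/
theorem not_exists_notBounding_isPrefix_iff :
    (¬∃ σ ∈ notBounding E, IsPrefix σ f) ↔ Extendible E f [] := by
  constructor
  · intro h m
    by_contra hm
    refine h ⟨_, ?_, isPrefix_map_range f m⟩
    rintro ⟨u, hu, hb, hE⟩
    have hu : u.length = m := by simpa using hu
    refine hm ⟨u, hu, fun k b hk => hb k b _ hk (getElem?_map_range f ?_), hE⟩
    exact hu ▸ (List.getElem?_eq_some_iff.1 hk).1
  · rintro h ⟨σ, hσ, hp⟩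
    obtain ⟨u, hu, hb, hE⟩ := h σ.length
    exact hσ ⟨u, hu, fun k b c hkb hkc => hp.eq_of_getElem? hkc ▸ hb k b hkb, hE⟩

/-! ### Arithmeticity of the leftmost path -/

section Arith

variable {α : Type} [Primcodable α] {E : Baire → α → Set (List ℕ)} {f : Baire → α → Baire}
  {u : Baire → α → List ℕ}

theorem ArithPred.forall_not_isPrefix (hE : ArithSet E) (hu : ArithFun u) :
    ArithPred fun O a => ∀ s ∈ E O a, ¬s <+: u O a :=
  all (R := fun O a s => s ∈ E O a → ¬s <+: u O a)
    ((hE.lift.mem ArithFun.var).imp (isPrefix ArithFun.var hu.lift).not)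

theorem ArithPred.boundedFree (hE : ArithSet E) (hf : ArithSeq f) (hu : ArithFun u) :
    ArithPred fun O a => BoundedFree (E O a) (f O a) (u O a) := by
  refine .and (.all (.all ?_)) (forall_not_isPrefix hE hu)
  exact (getElem? hu.lift.lift ArithFun.var.lift ArithFun.var).imp
    (le ArithFun.var (hf.lift.lift.app ArithFun.var.lift))

theorem ArithPred.extendible (hE : ArithSet E) (hf : ArithSeq f) (hu : ArithFun u) :
    ArithPred fun O a => Extendible (E O a) (f O a) (u O a) := by
  refine .all (.ex ?_)
  exact (eq (ArithFun.prim Primrec.list_length ArithFun.var) ArithFun.var.lift).and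
    (boundedFree hE.lift.lift hf.lift.lift
      (ArithFun.prim₂ Primrec.list_append hu.lift.lift ArithFun.var))

theorem ArithPred.leftmost (hE : ArithSet E) (hf : ArithSeq f) (hu : ArithFun u) :
    ArithPred fun O a => Leftmost (E O a) (f O a) (u O a) := by
  refine .all (.all (.all (.imp ?_ (.and ?_ (.all (.imp ?_ (.not ?_)))))))
  · exact eq hu.lift.lift.lift (ArithFun.prim₂ Primrec.list_append ArithFun.var.lift.lift
      (ArithFun.prim₂ Primrec.list_cons ArithFun.var.lift ArithFun.var))
  · exact extendible hE.lift.lift.lift hf.lift.lift.lift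
      (ArithFun.prim₂ Primrec.list_concat ArithFun.var.lift.lift ArithFun.var.lift)
  · exact lt ArithFun.var ArithFun.var.lift.lift
  · exact extendible hE.lift.lift.lift.lift hf.lift.lift.lift.lift
      (ArithFun.prim₂ Primrec.list_concat ArithFun.var.lift.lift.lift ArithFun.var)

theorem ArithSeq.leftmostPath (hE : ArithSet E) (hf : ArithSeq f) :
    ArithSeq fun O a => leftmostPath (E O a) (f O a) := by
  refine ArithFun.search (R := fun O (x : α × ℕ) a => ∃ u : List ℕ, u.length = x.2 ∧
    Leftmost (E O x.1) (f O x.1) (u ++ [a])) (.ex ?_)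
  exact (ArithPred.eq (ArithFun.prim Primrec.list_length ArithFun.var) ArithFun.var.lift.lift).and
    (ArithPred.leftmost hE.lift.lift.lift hf.lift.lift.lift
      (ArithFun.prim₂ Primrec.list_concat ArithFun.var ArithFun.var.lift))

theorem ArithSet.notBounding (hE : ArithSet E) : ArithSet fun O a => notBounding (E O a) := by
  refine ArithPred.not (.ex (.and ?_ (.and (.all (.all (.all (.imp ?_ (.imp ?_ ?_))))) ?_)))
  · exact .eq (ArithFun.var.prim Primrec.list_length)
      (ArithFun.var.lift.prim Primrec.list_length)
  · exact .getElem? ArithFun.var.lift.lift.lift ArithFun.var.lift.lift ArithFun.var.lift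
  · exact .getElem? ArithFun.var.lift.lift.lift.lift ArithFun.var.lift.lift ArithFun.var
  · exact .le ArithFun.var.lift ArithFun.var
  · exact .forall_not_isPrefix hE.lift.lift ArithFun.var

end Arith

theorem exists_strictMono_le (x : Baire) : ∃ g : Baire, StrictMono g ∧ ∀ n, x n ≤ g n := by
  refine ⟨fun n => ∑ i ∈ Finset.range (n + 1), (x i + 1), strictMono_nat_of_lt_succ fun n => ?_,
    fun n => ?_⟩
  · rw [Finset.sum_range_succ _ (n + 1)]
    omega
  · dsimp only
    rw [Finset.sum_range_succ]
    omega

/-- The instance must be shown to have a solution, and no appeal to the open Ramsey theorem is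
needed. If `x` has no prefix in `E`, an increasing `f` above `x` works, because `f ∘ g` stays above
`x`. Otherwise every bounded tree is finite, as a leftmost path would be a point without prefix in
`E`; so every sequence is in the open set. -/
theorem HS_openOf_nonempty (E : Set (List ℕ)) :
    (HS (openOf Ramsey (notBounding E) : Set Ramsey)).Nonempty := by
  by_cases h : ∃ x : Baire, ¬∃ s ∈ E, IsPrefix s x
  · obtain ⟨x, hx⟩ := h
    obtain ⟨f, hf, hle⟩ := exists_strictMono_le x
    refine ⟨⟨f, hf⟩, Or.inr fun g => ?_⟩
    rw [SetLike.mem_coe, mem_openOf, not_exists_notBounding_isPrefix_iff]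
    exact extendible_nil_of_le hx fun n => (hle n).trans (hf.monotone g.2.le_apply)
  · refine ⟨⟨id, strictMono_id⟩, Or.inl fun g => ?_⟩
    rw [SetLike.mem_coe, mem_openOf]
    by_contra hg
    exact h ⟨_, not_exists_isPrefix_leftmostPath (not_exists_notBounding_isPrefix_iff.1 hg)⟩

theorem totalChoiceBaire_star_reducible : ArithReducible totalChoiceBaire.star openRT.star := by
  have hE : ArithSet fun O (x : ℕ) => stringsOf (entry O x) :=
    arithSet_entry (ArithFun.of_primrec Primrec.id)
  have hφ : ArithFun fun O (x : ℕ × ℕ) => nameOf (notBounding (stringsOf (entry O x.1))) x.2 :=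
    arithSeq_nameOf hE.notBounding
  have hψ : ArithFun fun O (x : ℕ × ℕ) =>
      leftmostPath (stringsOf (entry (evenPart O) x.1)) (entry (oddPart O) x.1) x.2 :=
    ArithSeq.leftmostPath (E := fun O x => stringsOf (entry (evenPart O) x))
      (ArithPred.of_oracle hE totalRec_evenPart)
      (ArithFun.of_oracle (arithSeq_entry (ArithFun.of_primrec Primrec.id)) totalRec_oddPart)
  refine ArithReducible.star_of 1
    (φ := fun O i => nameOf (notBounding (stringsOf (entry O i))))
    (ψ := fun O i => leftmostPath (stringsOf (entry (evenPart O) i)) (entry (oddPart O) i))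
    hφ hψ ?_
  intro p i (A : TopologicalSpace.Closeds Baire) hA _
  have hmem := mem_iff_of_closedRep hA
  refine ⟨fun _ => openOf Ramsey (notBounding (stringsOf (entry p i))),
    fun _ => HS_openOf_nonempty _, fun j => ?_, fun b hb => ⟨_, fun hd => ?_, rfl⟩⟩
  · rw [show (j : ℕ) + 1 * i = i by omega]
    exact openRep_nameOf Ramsey (notBounding (stringsOf (entry p i)))
  · obtain ⟨x, hx⟩ := hd
    obtain ⟨f, hf, hbf⟩ := hb 0
    rw [show ((0 : Fin 1) : ℕ) + 1 * i = i by simp] at hbf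
    have hbf : entry b i = f.1 := hbf
    refine (hmem _).2 ?_
    rw [evenPart_join, oddPart_join, hbf]
    refine not_exists_isPrefix_leftmostPath ?_
    obtain ⟨g, hg, hle⟩ := exists_strictMono_le x
    rcases hf with hf | hf
    -- The sequence `f ∘ g` bounds the point `x` of `A`, so the tree below it is infinite, and `f`
    -- is not homogeneous for the open set.
    · refine absurd (hf ⟨g, hg⟩) ?_
      rw [SetLike.mem_coe, mem_openOf, not_exists_notBounding_isPrefix_iff]
      exact extendible_nil_of_le ((hmem x).1 hx) fun n => (hle n).trans f.2.le_apply
    -- The identity shows that `f` itself is outside the open set.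
    · have := hf ⟨id, strictMono_id⟩
      rwa [SetLike.mem_coe, mem_openOf, not_exists_notBounding_isPrefix_iff] at this

end ChoiceToRamsey

end Weihrauch

theorem mainTheorem12 :
    Weihrauch.ArithEquiv Weihrauch.openRT.star Weihrauch.totalChoiceBaire.star :=
  ⟨Weihrauch.openRT_star_reducible, Weihrauch.totalChoiceBaire_star_reducible⟩
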